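/- **Setting.** Let $d\ge 0$, and let $A=(a_1,\dots,a_n)$ be points of $\mathbb{R}^d$, possibly repeated or affinely dependent, whose affine span is $\mathbb{R}^d$. Put $v_i=(a_i,1)\in\mathbb{R}^{d+1}$, $V=(v_1,\dots,v_n)$ and $Z(V)=\sum_{i=1}^n[0,v_i]$. For $B\subseteq[n]$ with $|B|=d+1$ and $(a_b)_{b\in B}$ affinely independent, let $\det(B)>0$ be the absolute value of the determinant with rows $(a_b,1)$, $b\in B$. For $b\in B$ let $\lambda_{B,b}(x)$ be the $b$-th barycentric coordinate of $x$, i.e. the quotient of the determinant with row $(a_b,1)$ replaced by $(x,1)$ and the determinant with rows $(a_b,1)$ (same order of rows). For such $B$ and $I\subseteq[n]\setminus B$ let $\Pi_{I,B}=\sum_{i\in I}v_i+\sum_{b\in B}[0,v_b]$. Its faces are the sets $\Pi_{J,C}$ with $C\subseteq B$ and $I\subseteq J\subseteq I\cup(B\setminus C)$. A *fine zonotopal tiling* of $Z(V)$ is a finite collection $\mathcal P$ of labelled tiles $\Pi_{I,B}$ whose union is $Z(V)$ and such that the intersection of any two of them is empty or a common face $\Pi_{J,C}$ of both, with the same label $(J,C)$.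 For $X\subseteq[n]$ with $|X|=k+d+1$, the *simplex spline* $M(\cdot\,|X)$ is defined recursively. It is $0$ if the points $(a_i)_{i\in X}$ do not affinely span $\mathbb{R}^d$. Otherwise $$M(x|X)=\frac{d!}{\det(X)}\mathbf 1_X(x)\ \ (k=0),\qquad M(x|X)=\frac{k+d}{k}\sum_{b\in B}\lambda_{B,b}(x)\,M(x|X\setminus\{b\})\ \ (k\ge1),$$ where $B=B(X)\subseteq X$ is any chosen set of $d+1$ indices of affinely independent points, and $\mathbf 1_X$ is the indicator function of $\mathrm{ch}(\{a_i\}_{i\in X})$. **Theorem.** Let $\mathcal P$ be a fine zonotopal tiling of $Z(V)$, let $0\le k\le n-d-1$, let $\mathcal P^{(k)}=\{\Pi_{I,B}\in\mathcal P:|I|=k\}$ and $$\mathrm{ch}_k(A)=\bigcap_{S\subseteq[n],\,|S|=n-k}\mathrm{ch}(\{a_i\}_{i\in S}).$$ Let $q$ be a real polynomial of degree at most $k$ on $\mathbb{R}^d$, and let $Q$ be its polar form, i.e. the function of $k$ arguments in $\mathbb{R}^d$ which is symmetric, affine in each argument and satisfies $Q(x,\dots,x)=q(x)$ (it exists). Consider,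 for any choice of the sets $B(X)$ in the recursion, the identity $$q(x)=\frac{k!}{(k+d)!}\sum_{\Pi_{I,B}\in\mathcal P^{(k)}}Q((a_i)_{i\in I})\,\mathrm{vol}^{d+1}(\Pi_{I,B})\,M(x\,|\,I\cup B).\qquad(*)$$ 1. $(*)$ holds for every $x\in\mathrm{ch}_k(A)$ that lies in none of the sets $\mathrm{ch}(\{a_i\}_{i\in S})$, $S\subseteq[n]$, $|S|=d$; in particular it holds for almost every $x\in\mathrm{ch}_k(A)$. 2. $(*)$ holds for every $x\in\mathrm{ch}_k(A)$ without exception, if the values of the splines on this exceptional null set are fixed as follows: for an arbitrary fixed point $p\in\mathrm{ch}(A)$ that lies on none of the affine spans $\mathrm{aff}(\{a_i\}_{i\in S})$, $|S|=d$, the value $\mathbf 1_X(x)$ in the recursion is $1$ if $x+t(p-x)\in\mathrm{ch}(\{a_i\}_{i\in X})$ for all sufficiently small $t>0$, and $0$ otherwise. -/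

import Mathlib

open MeasureTheory Topology

noncomputable section

namespace ZonotopalSpline

/-- The projective lift `(x, 1) ∈ ℝ^(d+1)` of a point `x ∈ ℝ^d`. -/
def lift {d : ℕ} (x : Fin d → ℝ) : Fin (d + 1) → ℝ :=
  Fin.snoc x 1

/-- `B` indexes `d + 1` affinely independent points of the configuration `a`. -/
def IsBasis {d n : ℕ} (a : Fin n → Fin d → ℝ) (B : Finset (Fin n)) : Prop :=
  B.card = d + 1 ∧ AffineIndependent ℝ (fun i : B => a i)

/-- The determinant of the `(d+1) × (d+1)` matrix with rows `(a_i, 1)`, `i ∈ B`, taken in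
increasing order of the index (and `0` if `B` does not have `d + 1` elements). -/
def orderedDet {d n : ℕ} (a : Fin n → Fin d → ℝ) (B : Finset (Fin n)) : ℝ :=
  if h : B.card = d + 1 then
    Matrix.det (Matrix.of fun i : Fin (d + 1) => lift (a (B.orderEmbOfFin h i)))
  else 0

/-- The determinant `det(B) > 0`, with the rows ordered so that it is positive. -/
def posDet {d n : ℕ} (a : Fin n → Fin d → ℝ) (B : Finset (Fin n)) : ℝ :=
  |orderedDet a B|

/-- The quotient `det(B; b → x) / det(B)`: in the numerator the row `(a_b, 1)` is replaced by
`(x, 1)`. The quotient does not depend on the order of the rows. -/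
def detQuot {d n : ℕ} (a : Fin n → Fin d → ℝ) (B : Finset (Fin n)) (b : Fin n)
    (x : Fin d → ℝ) : ℝ :=
  orderedDet (Function.update a b x) B / orderedDet a B

/-- The convex hull of the points indexed by `S`. -/
def hull {d n : ℕ} (a : Fin n → Fin d → ℝ) (S : Finset (Fin n)) : Set (Fin d → ℝ) :=
  convexHull ℝ (a '' (S : Set (Fin n)))

/-- `ch_k(A)`: the intersection of the convex hulls of all subconfigurations of size `n - k`. -/
def chk {d n : ℕ} (a : Fin n → Fin d → ℝ) (k : ℕ) : Set (Fin d → ℝ) :=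
  {x | ∀ S : Finset (Fin n), S.card + k = n → x ∈ hull a S}

/-- The zonotope `Z(V) = ∑ [0, v_i]`, where `v_i = (a_i, 1)`. -/
def zonotope {d n : ℕ} (a : Fin n → Fin d → ℝ) : Set (Fin (d + 1) → ℝ) :=
  {z | ∃ α : Fin n → ℝ, (∀ i, α i ∈ Set.Icc (0 : ℝ) 1) ∧ z = ∑ i, α i • lift (a i)}

/-- The parallelepiped `Π_{I,B} = ∑_{i ∈ I} v_i + ∑_{b ∈ B} [0, v_b]`, where `T = (I, B)`. -/
def tile {d n : ℕ} (a : Fin n → Fin d → ℝ) (T : Finset (Fin n) × Finset (Fin n)) :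
    Set (Fin (d + 1) → ℝ) :=
  {z | ∃ α : Fin n → ℝ, (∀ i, α i ∈ Set.Icc (0 : ℝ) 1) ∧
    z = ∑ i ∈ T.1, lift (a i) + ∑ b ∈ T.2, α b • lift (a b)}

/-- `Π_{J,C}` is a face of `Π_{I,B}` (`F = (J, C)`, `T = (I, B)`): it is obtained by setting the
coefficients of the segments `[0, v_b]`, `b ∈ B \ C`, equal to `1` (for `b ∈ J`) or `0`. -/
def IsFace {n : ℕ} (F T : Finset (Fin n) × Finset (Fin n)) : Prop :=
  F.2 ⊆ T.2 ∧ T.1 ⊆ F.1 ∧ F.1 ⊆ T.1 ∪ (T.2 \ F.2)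

/-- `P` is (the set of labels `(I, B)` of the tiles of) a fine zonotopal tiling of `Z(V)`: the
tiles cover `Z(V)`, and any two tiles meet in a common face, possibly empty. -/
structure IsFineZonotopalTiling {d n : ℕ} (a : Fin n → Fin d → ℝ)
    (P : Finset (Finset (Fin n) × Finset (Fin n))) : Prop where
  disjoint : ∀ T ∈ P, Disjoint T.1 T.2
  basis : ∀ T ∈ P, IsBasis a T.2
  cover : (⋃ T ∈ P, tile a T) = zonotope a
  inter : ∀ T ∈ P, ∀ T' ∈ P, tile a T ∩ tile a T' = ∅ ∨
    ∃ F, IsFace F T ∧ IsFace F T' ∧ tile a T ∩ tile a T' = tile a F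

/-- A rule choosing, for each `X` whose points have full affine rank, the set `B ⊆ X` of `d + 1`
affinely independent points which is used in the spline recursion. -/
def IsSelection {d n : ℕ} (a : Fin n → Fin d → ℝ) (sel : Finset (Fin n) → Finset (Fin n)) :
    Prop :=
  ∀ X : Finset (Fin n), (∃ B ⊆ X, IsBasis a B) → sel X ⊆ X ∧ IsBasis a (sel X)

open Classical in
/-- The normalized simplex spline `M(x | (a_i)_{i ∈ X})` of degree `k`, where `X` has `k + d + 1`
elements, computed by the recursion with the choices `sel`; it is zero if the points indexed by `X`
do not have full affine rank. The function `χ B` is the indicator function of the simplex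
with vertices indexed by `B`. -/
def spline {d n : ℕ} (a : Fin n → Fin d → ℝ) (χ : Finset (Fin n) → (Fin d → ℝ) → ℝ)
    (sel : Finset (Fin n) → Finset (Fin n)) : ℕ → Finset (Fin n) → (Fin d → ℝ) → ℝ
  | 0, X, x =>
    if IsBasis a X then (d.factorial : ℝ) / posDet a X * χ X x else 0
  | k + 1, X, x =>
    if ∃ B ⊆ X, IsBasis a B then
      ((k + 1 + d : ℕ) : ℝ) / ((k + 1 : ℕ) : ℝ) *
        ∑ b ∈ sel X, detQuot a (sel X) b x * spline a χ sel k (X.erase b) x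
    else 0

/-- The indicator function of the closed convex hull of the points indexed by `X`. -/
def closedInd {d n : ℕ} (a : Fin n → Fin d → ℝ) (X : Finset (Fin n)) : (Fin d → ℝ) → ℝ :=
  Set.indicator (hull a X) 1

/-- The indicator function of the half-open convex hull of the points indexed by `X`, as seen from
`p`: its value at `x` is the limit of the closed indicator function along the segment from `x`
towards `p`. -/
def halfOpenInd {d n : ℕ} (a : Fin n → Fin d → ℝ) (p : Fin d → ℝ) (X : Finset (Fin n)) :
    (Fin d → ℝ) → ℝ :=
  Set.indicator {x | ∀ᶠ t in 𝓝[>] (0 : ℝ), x + t • (p - x) ∈ hull a X} 1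

/-- `Q` is the polar form of `q`, as a polynomial of degree at most `k`: it is symmetric, affine in
each of its `k` arguments, and agrees with `q` on the diagonal. -/
structure IsPolarForm {d : ℕ} (k : ℕ) (q : MvPolynomial (Fin d) ℝ)
    (Q : (Fin k → Fin d → ℝ) → ℝ) : Prop where
  symm : ∀ (π : Equiv.Perm (Fin k)) (y : Fin k → Fin d → ℝ), Q (y ∘ π) = Q y
  affine : ∀ (y : Fin k → Fin d → ℝ) (j : Fin k),
    ∃ f : (Fin d → ℝ) →ᵃ[ℝ] ℝ, ∀ z, Q (Function.update y j z) = f z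
  diag : ∀ x : Fin d → ℝ, Q (fun _ => x) = MvPolynomial.eval x q

/-- The value `Q((a_i)_{i ∈ I})`, where `I` has `k` elements. -/
def polarAt {d n k : ℕ} (a : Fin n → Fin d → ℝ) (Q : (Fin k → Fin d → ℝ) → ℝ)
    (I : Finset (Fin n)) : ℝ :=
  if h : I.card = k then Q (fun j => a (I.orderEmbOfFin h j)) else 0

/-- The sum
`k! / (k+d)! ∑_{(I,B) ∈ P, |I| = k} Q((a_i)_{i ∈ I}) vol(Π_{I,B}) M(x | (a_i)_{i ∈ I ∪ B})`. -/
def splineSum {d n : ℕ} (a : Fin n → Fin d → ℝ) (χ : Finset (Fin n) → (Fin d → ℝ) → ℝ)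
    (sel : Finset (Fin n) → Finset (Fin n)) (P : Finset (Finset (Fin n) × Finset (Fin n))) (k : ℕ)
    (Q : (Fin k → Fin d → ℝ) → ℝ) (x : Fin d → ℝ) : ℝ :=
  (k.factorial : ℝ) / ((k + d).factorial : ℝ) *
    ∑ T ∈ P with T.1.card = k,
      polarAt a Q T.1 * volume.real (tile a T) * spline a χ sel k (T.1 ∪ T.2) x

end ZonotopalSpline

end

noncomputable section

namespace ZonotopalSpline

/-! A tile has volume det(B), so the claim reads: the sum over the tiles with |I| = k of Q(a_I)
det(B) M(x | I ∪ B) equals (k+d)!/k! · Q(x,…,x). It is proved by induction on k, for all symmetric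
multiaffine Q.

First, the spline recursion must not depend on the chosen basis. This follows from the stronger fact
`RespectsRelations`: a linear relation Σ μ_b v_b = 0 on X forces Σ μ_b M(x | X∖b) = 0. In degree 0
it says that a generic point lying in some simplex X∖b with μ_b ≠ 0 lies in exactly one with μ_b > 0
and exactly one with μ_b < 0; the passage to higher degree is an antisymmetry argument.

For the step from k to k+1, M(x | I ∪ B) is expanded in the basis B of its own tile. The product
det(B) λ_{B,b}(x) is, up to a sign telling on which side of the facet C = B∖b the tile lies, a
quantity depending only on C and x. Regrouped by facets Π_{J,C} with |J| = k+1, the contributions of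
the tiles on the two sides of an interior facet cancel (`sum_signs_eq_zero`). On a boundary facet
the zonotope stays on one side, which puts ch(Jᶜ) and ch(J ∪ C) on opposite sides of aff(C). Since x
∈ ch_{k+1}(A) lies in the former, either x ∉ ch(J ∪ C) and the spline vanishes, or x ∈ aff(C) and
the coordinate vanishes. A facet with |J| = k+1 is a lower facet of a tile with |I| = k+1 or an
upper facet of one with |I| = k, so the sum moves to level k, where affinity of Q turns Σ λ_b Q(a_b,
a_I) into Q(x, a_I). The base case is the triangulation given by the tiles with I = ∅.

For the half-open convention, x is replaced by a nearby generic point y, but only inside the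
indicator functions. -/

theorem exists_perm_of_range_subset {ι β : Type*} [Finite ι] {f g : ι → β}
    (hf : Function.Injective f) (h : ∀ i, ∃ j, g j = f i) :
    ∃ σ : Equiv.Perm ι, f = g ∘ σ := by
  choose s hs using h
  have hi : Function.Injective s := fun i j hij => hf (by rw [← hs i, ← hs j, hij])
  refine ⟨Equiv.ofBijective s (Finite.injective_iff_bijective.1 hi), ?_⟩
  funext i
  simp [hs]

/-! ### Lifted points, determinants and barycentric coordinates -/

section Lift

variable {d : ℕ}

@[simp] theorem lift_last (x : Fin d → ℝ) : lift x (Fin.last d) = 1 := by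
  simp [lift]

@[simp] theorem lift_castSucc (x : Fin d → ℝ) (j : Fin d) : lift x j.castSucc = x j := by
  simp [lift]

end Lift

variable {d n : ℕ}

theorem sum_smul_lift_eq_lift {a : Fin n → Fin d → ℝ} {S : Finset (Fin n)} {w : Fin n → ℝ}
    {x : Fin d → ℝ} :
    ∑ i ∈ S, w i • lift (a i) = lift x ↔ ∑ i ∈ S, w i = 1 ∧ ∑ i ∈ S, w i • a i = x := by
  constructor
  · intro h
    refine ⟨by simpa using congrFun h (Fin.last d), ?_⟩
    funext j
    simpa using congrFun h j.castSucc
  · rintro ⟨h1, h2⟩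
    funext j
    refine Fin.lastCases ?_ (fun j => ?_) j
    · simpa using h1
    · simpa using congrFun h2 j

theorem sum_smul_lift_eq_zero {ι : Type*} {a : ι → Fin d → ℝ} {S : Finset ι} {w : ι → ℝ} :
    ∑ i ∈ S, w i • lift (a i) = 0 ↔ ∑ i ∈ S, w i = 0 ∧ ∑ i ∈ S, w i • a i = 0 := by
  constructor
  · intro h
    refine ⟨by simpa using congrFun h (Fin.last d), ?_⟩
    funext j
    simpa using congrFun h j.castSucc
  · rintro ⟨h1, h2⟩
    funext j
    refine Fin.lastCases ?_ (fun j => ?_) j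
    · simpa using h1
    · simpa using congrFun h2 j

theorem mem_hull_iff {a : Fin n → Fin d → ℝ} {S : Finset (Fin n)} {x : Fin d → ℝ} :
    x ∈ hull a S ↔ ∃ w : Fin n → ℝ, (∀ i, 0 ≤ w i) ∧ (∀ i ∉ S, w i = 0) ∧
      ∑ i ∈ S, w i • lift (a i) = lift x := by
  constructor
  · intro h
    have hsub : hull a S ⊆ {x | ∃ w : Fin n → ℝ, (∀ i, 0 ≤ w i) ∧ (∀ i ∉ S, w i = 0) ∧
        ∑ i ∈ S, w i • lift (a i) = lift x} := by
      refine convexHull_min ?_ ?_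
      · rintro _ ⟨i, hi, rfl⟩
        refine ⟨Pi.single i 1, fun j => ?_, fun j hj => ?_, ?_⟩
        · by_cases h : j = i
          · subst h; simp
          · simp [h]
        · have : j ≠ i := by rintro rfl; exact hj hi
          simp [this]
        · rw [Finset.sum_eq_single i]
          · simp
          · intro j _ hj; simp [hj]
          · intro h; exact absurd hi h
      · rintro x ⟨w, hw, hw0, hwx⟩ y ⟨w', hw', hw0', hwy⟩ s t hs ht hst
        refine ⟨fun i => s * w i + t * w' i, fun i => ?_, fun i hi => ?_, ?_⟩
        · have := hw i; have := hw' i; positivity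
        · simp [hw0 i hi, hw0' i hi]
        · rw [sum_smul_lift_eq_lift] at *
          obtain ⟨h1, h2⟩ := hwx
          obtain ⟨h3, h4⟩ := hwy
          constructor
          · rw [Finset.sum_add_distrib, ← Finset.mul_sum, ← Finset.mul_sum, h1, h3]; simpa using hst
          · simp only [add_smul, mul_smul, Finset.sum_add_distrib, ← Finset.smul_sum, h2, h4]
    exact hsub h
  · rintro ⟨w, hw, -, hwx⟩
    rw [sum_smul_lift_eq_lift] at hwx
    rw [← hwx.2]
    exact (convex_convexHull ℝ _).sum_mem (fun i _ => hw i) hwx.1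
      (fun i hi => subset_convexHull ℝ _ ⟨i, hi, rfl⟩)

theorem hull_mono {a : Fin n → Fin d → ℝ} {S S' : Finset (Fin n)} (h : S ⊆ S') :
    hull a S ⊆ hull a S' :=
  convexHull_mono (Set.image_mono (by exact_mod_cast h))

theorem isBasis_iff_linear {a : Fin n → Fin d → ℝ} {B : Finset (Fin n)} :
    IsBasis a B ↔ B.card = d + 1 ∧ LinearIndependent ℝ (fun i : B => lift (a i)) := by
  unfold IsBasis
  refine and_congr_right fun _ => ?_
  rw [affineIndependent_iff, linearIndependent_iff']
  refine forall_congr' fun s => forall_congr' fun w => ?_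
  rw [sum_smul_lift_eq_zero (a := fun i : B => a i), and_imp]

theorem isBasis_iff_posDet {a : Fin n → Fin d → ℝ} {B : Finset (Fin n)} :
    IsBasis a B ↔ posDet a B ≠ 0 := by
  rw [isBasis_iff_linear]
  by_cases h : B.card = d + 1
  · rw [posDet, abs_ne_zero, orderedDet, dif_pos h, ← isUnit_iff_ne_zero,
      ← Matrix.isUnit_iff_isUnit_det, ← Matrix.linearIndependent_rows_iff_isUnit,
      ← linearIndependent_equiv (B.orderIsoOfFin h).toEquiv]
    simp only [h, true_and]
    rfl
  · simp [posDet, orderedDet, h]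

theorem IsBasis.posDet_pos {a : Fin n → Fin d → ℝ} {B : Finset (Fin n)} (h : IsBasis a B) :
    0 < posDet a B :=
  lt_of_le_of_ne (abs_nonneg _) (isBasis_iff_posDet.1 h).symm

/-- The linear functional `z ↦ det(z, (v_c)_{c ∈ C})` vanishing on the hyperplane spanned by the
lifted points indexed by `C`. -/
def facetForm (a : Fin n → Fin d → ℝ) (C : Finset (Fin n)) : (Fin (d + 1) → ℝ) →ₗ[ℝ] ℝ :=
  if h : C.card = d then
    (Matrix.detRowAlternating (R := ℝ) (n := Fin (d + 1))).toMultilinearMap.toLinearMap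
      (Fin.cons 0 fun j => lift (a (C.orderEmbOfFin h j))) 0
  else 0

theorem facetForm_apply {a : Fin n → Fin d → ℝ} {C : Finset (Fin n)} (h : C.card = d)
    (z : Fin (d + 1) → ℝ) :
    facetForm a C z =
      Matrix.det (Matrix.of (Fin.cons z fun j => lift (a (C.orderEmbOfFin h j)))) := by
  simp only [facetForm, dif_pos h]
  change Matrix.det (Function.update _ _ _) = _
  rw [Fin.update_cons_zero]
  rfl

theorem facetForm_lift_of_mem {a : Fin n → Fin d → ℝ} {C : Finset (Fin n)} {c : Fin n}
    (hc : c ∈ C) : facetForm a C (lift (a c)) = 0 := by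
  by_cases h : C.card = d
  · rw [facetForm_apply h]
    have : c ∈ Set.range (C.orderEmbOfFin h) := by rw [Finset.range_orderEmbOfFin]; exact hc
    obtain ⟨j, hj⟩ := this
    refine Matrix.det_zero_of_row_eq (i := 0) (j := j.succ) (Fin.succ_ne_zero j).symm ?_
    funext i
    simp [hj]
  · simp [facetForm, h]

theorem facetForm_congr {a a' : Fin n → Fin d → ℝ} {C : Finset (Fin n)}
    (h : ∀ c ∈ C, a c = a' c) : facetForm a C = facetForm a' C := by
  by_cases hC : C.card = d
  · refine LinearMap.ext fun z => ?_
    simp only [facetForm_apply hC]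
    have : (fun j => lift (a (C.orderEmbOfFin hC j))) = fun j => lift (a' (C.orderEmbOfFin hC j)) := by
      funext j
      rw [h _ (Finset.orderEmbOfFin_mem C hC j)]
    rw [this]
  · simp [facetForm, hC]

/-- The sign is that of the permutation sorting `b` into `C`. It does not depend on the points `a`,
so it cancels in `detQuot`, where one point is replaced by `x`. -/
theorem exists_orderedDet_insert {C : Finset (Fin n)} {b : Fin n} (hb : b ∉ C) :
    ∃ ε : ℝ, |ε| = 1 ∧ ∀ a : Fin n → Fin d → ℝ,
      orderedDet a (insert b C) = ε * facetForm a C (lift (a b)) := by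
  by_cases h : C.card = d
  · have h' : (insert b C).card = d + 1 := by rw [Finset.card_insert_of_notMem hb, h]
    have hinj : Function.Injective (Fin.cons b (C.orderEmbOfFin h) : Fin (d + 1) → Fin n) := by
      rw [Fin.cons_injective_iff]
      refine ⟨?_, (C.orderEmbOfFin h).injective⟩
      rw [Finset.range_orderEmbOfFin]; exact hb
    obtain ⟨σ, hσ⟩ := exists_perm_of_range_subset (g := (insert b C).orderEmbOfFin h') hinj (by
      intro i
      have : (Fin.cons b (C.orderEmbOfFin h) : Fin (d + 1) → Fin n) i ∈
          Set.range ((insert b C).orderEmbOfFin h') := by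
        rw [Finset.range_orderEmbOfFin]
        refine Fin.cases ?_ (fun j => ?_) i
        · simp
        · simp
      exact this)
    refine ⟨(Equiv.Perm.sign σ : ℤ), ?_, fun a => ?_⟩
    · rcases Int.units_eq_one_or (Equiv.Perm.sign σ) with h | h <;> simp [h]
    · have key : Matrix.of (Fin.cons (lift (a b)) fun j => lift (a (C.orderEmbOfFin h j))) =
          (Matrix.of fun i : Fin (d + 1) => lift (a ((insert b C).orderEmbOfFin h' i))).submatrix
            σ id := by
        funext i j
        have := congrFun hσ i
        simp only [Function.comp_apply] at this
        simp only [Matrix.of_apply, Matrix.submatrix_apply, id, ← this]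
        refine Fin.cases ?_ (fun j => ?_) i
        · simp
        · simp
      rw [facetForm_apply h, key, Matrix.det_permute, orderedDet, dif_pos h', ← mul_assoc]
      rcases Int.units_eq_one_or (Equiv.Perm.sign σ) with h | h <;> simp [h]
  · refine ⟨1, by simp, fun a => ?_⟩
    have h' : (insert b C).card ≠ d + 1 := by rw [Finset.card_insert_of_notMem hb]; simpa using h
    simp [orderedDet, facetForm, h, h']

theorem posDet_insert {a : Fin n → Fin d → ℝ} {C : Finset (Fin n)} {b : Fin n} (hb : b ∉ C) :
    posDet a (insert b C) = |facetForm a C (lift (a b))| := by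
  obtain ⟨ε, hε, h⟩ := exists_orderedDet_insert (d := d) hb
  rw [posDet, h, abs_mul, hε, one_mul]

theorem posDet_eq_of_mem {a : Fin n → Fin d → ℝ} {B : Finset (Fin n)} {b : Fin n} (hb : b ∈ B) :
    posDet a B = |facetForm a (B.erase b) (lift (a b))| := by
  conv_lhs => rw [← Finset.insert_erase hb]
  exact posDet_insert (Finset.notMem_erase b B)

theorem IsBasis.facetForm_ne_zero {a : Fin n → Fin d → ℝ} {B : Finset (Fin n)} {b : Fin n}
    (h : IsBasis a B) (hb : b ∈ B) : facetForm a (B.erase b) (lift (a b)) ≠ 0 := by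
  rw [← abs_ne_zero, ← posDet_eq_of_mem hb]
  exact h.posDet_pos.ne'

theorem detQuot_eq {a : Fin n → Fin d → ℝ} {B : Finset (Fin n)} {b : Fin n} (hb : b ∈ B)
    (x : Fin d → ℝ) :
    detQuot a B b x =
      facetForm a (B.erase b) (lift x) / facetForm a (B.erase b) (lift (a b)) := by
  obtain ⟨ε, hε, h⟩ := exists_orderedDet_insert (d := d) (Finset.notMem_erase b B)
  rw [Finset.insert_erase hb] at h
  have hε0 : ε ≠ 0 := by rintro rfl; simp at hε
  rw [detQuot, h, h, mul_div_mul_left _ _ hε0, Function.update_self]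
  congr 2
  refine facetForm_congr fun c hc => ?_
  rw [Function.update_of_ne (Finset.ne_of_mem_erase hc)]

/-- The `b`-th coordinate of a vector in the basis of lifted points indexed by `B`. -/
def coordForm (a : Fin n → Fin d → ℝ) (B : Finset (Fin n)) (b : Fin n) :
    (Fin (d + 1) → ℝ) →ₗ[ℝ] ℝ :=
  (facetForm a (B.erase b) (lift (a b)))⁻¹ • facetForm a (B.erase b)

theorem coordForm_apply (a : Fin n → Fin d → ℝ) (B : Finset (Fin n)) (b : Fin n)
    (z : Fin (d + 1) → ℝ) :
    coordForm a B b z = facetForm a (B.erase b) z / facetForm a (B.erase b) (lift (a b)) := by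
  simp [coordForm, div_eq_inv_mul]

theorem detQuot_eq_coordForm {a : Fin n → Fin d → ℝ} {B : Finset (Fin n)} {b : Fin n}
    (hb : b ∈ B) (x : Fin d → ℝ) : detQuot a B b x = coordForm a B b (lift x) := by
  rw [detQuot_eq hb, coordForm_apply]

theorem IsBasis.coordForm_self {a : Fin n → Fin d → ℝ} {B : Finset (Fin n)} {b : Fin n}
    (h : IsBasis a B) (hb : b ∈ B) : coordForm a B b (lift (a b)) = 1 := by
  rw [coordForm_apply, div_self (h.facetForm_ne_zero hb)]

theorem coordForm_of_ne {a : Fin n → Fin d → ℝ} {B : Finset (Fin n)} {b c : Fin n}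
    (hc : c ∈ B) (hcb : c ≠ b) : coordForm a B b (lift (a c)) = 0 := by
  rw [coordForm_apply, facetForm_lift_of_mem (Finset.mem_erase.2 ⟨hcb, hc⟩), zero_div]

theorem IsBasis.coordForm_sum {a : Fin n → Fin d → ℝ} {B S : Finset (Fin n)} {b : Fin n}
    (h : IsBasis a B) (hb : b ∈ B) (hS : S ⊆ B) (w : Fin n → ℝ) :
    coordForm a B b (∑ i ∈ S, w i • lift (a i)) = if b ∈ S then w b else 0 := by
  rw [map_sum]
  simp only [map_smul, smul_eq_mul]
  have : ∀ i ∈ S, w i * coordForm a B b (lift (a i)) = if i = b then w b else 0 := by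
    intro i hi
    split_ifs with hib
    · rw [hib, h.coordForm_self hb, mul_one]
    · rw [coordForm_of_ne (hS hi) hib, mul_zero]
  rw [Finset.sum_congr rfl this, Finset.sum_ite_eq']

theorem IsBasis.sum_coordForm {a : Fin n → Fin d → ℝ} {B : Finset (Fin n)}
    (h : IsBasis a B) (z : Fin (d + 1) → ℝ) :
    ∑ b ∈ B, coordForm a B b z • lift (a b) = z := by
  have hli := (isBasis_iff_linear.1 h).2
  have hcard : Fintype.card B = Module.finrank ℝ (Fin (d + 1) → ℝ) := by
    simp [(isBasis_iff_linear.1 h).1]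
  have hspan := hli.span_eq_top_of_card_eq_finrank' hcard
  have hz : z ∈ Submodule.span ℝ (Set.range fun i : B => lift (a i)) := by rw [hspan]; trivial
  obtain ⟨w, hw⟩ := (Submodule.mem_span_range_iff_exists_fun ℝ).1 hz
  let w' : Fin n → ℝ := fun i => if hi : i ∈ B then w ⟨i, hi⟩ else 0
  have hw' : ∑ b ∈ B, w' b • lift (a b) = z := by
    rw [← hw, ← Finset.sum_coe_sort]
    refine Finset.sum_congr rfl fun i _ => ?_
    simp [w']
  conv_rhs => rw [← hw']
  refine Finset.sum_congr rfl fun b hb => ?_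
  rw [← hw', h.coordForm_sum hb subset_rfl, if_pos hb]

theorem IsBasis.sum_detQuot {a : Fin n → Fin d → ℝ} {B : Finset (Fin n)}
    (h : IsBasis a B) (x : Fin d → ℝ) :
    ∑ b ∈ B, detQuot a B b x • lift (a b) = lift x := by
  refine (Finset.sum_congr rfl fun b hb => ?_).trans (h.sum_coordForm (lift x))
  rw [detQuot_eq_coordForm hb]

theorem IsBasis.eq_zero_of_sum_eq_zero {a : Fin n → Fin d → ℝ} {B : Finset (Fin n)}
    (h : IsBasis a B) {w : Fin n → ℝ} (hw : ∑ b ∈ B, w b • lift (a b) = 0) :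
    ∀ b ∈ B, w b = 0 := by
  intro b hb
  have := h.coordForm_sum hb subset_rfl w
  rw [hw, map_zero, if_pos hb] at this
  exact this.symm

/-! ### Independence of the spline recursion from the chosen bases -/

section Spline

variable {a : Fin n → Fin d → ℝ} {χ : Finset (Fin n) → (Fin d → ℝ) → ℝ}
  {sel : Finset (Fin n) → Finset (Fin n)} {x : Fin d → ℝ}

theorem spline_eq_zero_of_no_basis {X : Finset (Fin n)} (h : ¬ ∃ B ⊆ X, IsBasis a B) (k : ℕ) :
    spline a χ sel k X x = 0 := by
  cases k with
  | zero => rw [spline, if_neg fun hX => h ⟨X, subset_rfl, hX⟩]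
  | succ k => rw [spline, if_neg h]

theorem spline_erase_eq_zero_of_no_basis {X : Finset (Fin n)} (h : ¬ ∃ B ⊆ X, IsBasis a B)
    (k : ℕ) (b : Fin n) : spline a χ sel k (X.erase b) x = 0 :=
  spline_eq_zero_of_no_basis
    (fun ⟨B, hB, hB'⟩ => h ⟨B, hB.trans (Finset.erase_subset b X), hB'⟩) k

/-- The recursion only deletes points, and hulls are monotone. This local support property disposes
of boundary facets later. -/
theorem mem_hull_of_spline_ne_zero (hχ : ∀ B, IsBasis a B → χ B x ≠ 0 → x ∈ hull a B)
    (k : ℕ) (X : Finset (Fin n)) (h : spline a χ sel k X x ≠ 0) : x ∈ hull a X := by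
  induction k generalizing X with
  | zero =>
    rw [spline] at h
    split_ifs at h with hX
    · exact hχ X hX (right_ne_zero_of_mul h)
    · exact absurd rfl h
  | succ k ih =>
    rw [spline] at h
    split_ifs at h with hX
    · obtain ⟨b, -, hb⟩ := Finset.exists_ne_zero_of_sum_ne_zero (right_ne_zero_of_mul h)
      exact hull_mono (Finset.erase_subset b X) (ih _ (right_ne_zero_of_mul hb))
    · exact absurd rfl h

/-- The splines of degree `k` at `x` satisfy a linear relation for every linear relation among the
lifted points. -/
def RespectsRelations (a : Fin n → Fin d → ℝ) (χ : Finset (Fin n) → (Fin d → ℝ) → ℝ)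
    (sel : Finset (Fin n) → Finset (Fin n)) (x : Fin d → ℝ) (k : ℕ) : Prop :=
  ∀ (X : Finset (Fin n)) (μ : Fin n → ℝ), ∑ b ∈ X, μ b • lift (a b) = 0 →
    ∑ b ∈ X, μ b * spline a χ sel k (X.erase b) x = 0

/-- Two representations of `lift x` over `X` differ by a linear relation, which the splines of
degree `k` annihilate. Hence any weights `ν` may replace the selected barycentric coordinates. -/
theorem RespectsRelations.spline_succ (hsel : IsSelection a sel) {k : ℕ}
    (hR : RespectsRelations a χ sel x k) {X : Finset (Fin n)} {ν : Fin n → ℝ}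
    (hν : ∑ b ∈ X, ν b • lift (a b) = lift x) :
    spline a χ sel (k + 1) X x = ((k + 1 + d : ℕ) : ℝ) / ((k + 1 : ℕ) : ℝ) *
      ∑ b ∈ X, ν b * spline a χ sel k (X.erase b) x := by
  by_cases hX : ∃ B ⊆ X, IsBasis a B
  · obtain ⟨hs, hB⟩ := hsel X hX
    rw [spline, if_pos hX]
    congr 1
    let ν' : Fin n → ℝ := fun b => if b ∈ sel X then detQuot a (sel X) b x else 0
    have h1 : ∑ b ∈ sel X, detQuot a (sel X) b x * spline a χ sel k (X.erase b) x =
        ∑ b ∈ X, ν' b * spline a χ sel k (X.erase b) x := by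
      rw [← Finset.sum_subset hs]
      · exact Finset.sum_congr rfl fun b hb => by simp [ν', hb]
      · intro b _ hb; simp [ν', hb]
    have h2 : ∑ b ∈ X, ν' b • lift (a b) = lift x := by
      rw [← hB.sum_detQuot x, ← Finset.sum_subset hs]
      · exact Finset.sum_congr rfl fun b hb => by simp [ν', hb]
      · intro b _ hb; simp [ν', hb]
    have h3 := hR X (fun b => ν' b - ν b) (by
      simp only [sub_smul, Finset.sum_sub_distrib]
      rw [h2, hν, sub_self])
    simp only [sub_mul, Finset.sum_sub_distrib] at h3
    rw [h1]
    linarith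
  · rw [spline_eq_zero_of_no_basis hX]
    simp [spline_erase_eq_zero_of_no_basis hX]

/-- With `lift x` = Σ ν_j v_j, each term μ_b M(X∖b) becomes a multiple of Σ_j (μ_b ν_j − ν_b μ_j)
D(b,j). The coefficients are antisymmetric and D is symmetric in the two deleted points, so the
double sum vanishes. -/
theorem RespectsRelations.succ (hsel : IsSelection a sel) {k : ℕ}
    (hR : RespectsRelations a χ sel x k) : RespectsRelations a χ sel x (k + 1) := by
  intro X μ hμ
  by_cases hX : ∃ B ⊆ X, IsBasis a B
  swap
  · simp [spline_erase_eq_zero_of_no_basis hX]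
  obtain ⟨B, hBX, hB⟩ := hX
  let ν : Fin n → ℝ := fun b => if b ∈ B then detQuot a B b x else 0
  have hν : ∑ b ∈ X, ν b • lift (a b) = lift x := by
    rw [← hB.sum_detQuot x, ← Finset.sum_subset hBX]
    · exact Finset.sum_congr rfl fun b hb => by simp [ν, hb]
    · intro b _ hb; simp [ν, hb]
  set D : Fin n → Fin n → ℝ := fun b j => spline a χ sel k ((X.erase b).erase j) x with hD
  have hDs : ∀ b j, D b j = D j b := fun b j => by simp only [hD, Finset.erase_right_comm]
  set r : ℝ := ((k + 1 + d : ℕ) : ℝ) / ((k + 1 : ℕ) : ℝ) with hr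
  have key : ∀ b ∈ X, μ b * spline a χ sel (k + 1) (X.erase b) x =
      r * ∑ j ∈ X, (μ b * ν j - ν b * μ j) * D b j := by
    intro b hb
    rw [← Finset.sum_erase X (a := b) (f := fun j => (μ b * ν j - ν b * μ j) * D b j)
      (by simp [mul_comm])]
    have hνb : ∑ j ∈ X.erase b, ν j • lift (a j) = lift x - ν b • lift (a b) := by
      rw [← hν, ← Finset.add_sum_erase X _ hb, add_sub_cancel_left]
    have hμb : ∑ j ∈ X.erase b, μ j • lift (a j) = - (μ b • lift (a b)) := by
      rw [← Finset.add_sum_erase X _ hb] at hμ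
      exact eq_neg_of_add_eq_zero_right hμ
    -- If μ_b = 0, then `μ` is already a relation on `X.erase b` and both sides vanish. Otherwise
    -- subtracting ν_b/μ_b times the relation eliminates `b` and represents `lift x` over `X.erase
    -- b`.
    by_cases h0 : μ b = 0
    · have := hR (X.erase b) μ (by rw [hμb, h0]; simp)
      have h2 : ∑ j ∈ X.erase b, (μ b * ν j - ν b * μ j) * D b j =
          - ν b * ∑ j ∈ X.erase b, μ j * D b j := by
        rw [Finset.mul_sum]
        exact Finset.sum_congr rfl fun j _ => by rw [h0]; ring
      rw [h2, this, h0]; ring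
    · rw [hR.spline_succ hsel (X := X.erase b) (ν := fun j => ν j - ν b / μ b * μ j)]
      · rw [mul_left_comm, Finset.mul_sum]
        congr 1
        refine Finset.sum_congr rfl fun j _ => ?_
        simp only [hD]
        field_simp
      · simp only [sub_smul, mul_smul, Finset.sum_sub_distrib, ← Finset.smul_sum]
        rw [hνb, hμb, smul_neg, smul_smul, div_mul_cancel₀ _ h0]
        abel
  rw [Finset.sum_congr rfl key, ← Finset.mul_sum]
  have hanti : ∑ b ∈ X, ∑ j ∈ X, (μ b * ν j - ν b * μ j) * D b j =
      - ∑ b ∈ X, ∑ j ∈ X, (μ b * ν j - ν b * μ j) * D b j := by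
    conv_lhs => rw [Finset.sum_comm]
    rw [← Finset.sum_neg_distrib]
    refine Finset.sum_congr rfl fun b _ => ?_
    rw [← Finset.sum_neg_distrib]
    refine Finset.sum_congr rfl fun j _ => ?_
    rw [hDs j b]; ring
  rw [self_eq_neg.1 hanti, mul_zero]

theorem RespectsRelations.of_zero (hsel : IsSelection a sel)
    (h : RespectsRelations a χ sel x 0) : ∀ k, RespectsRelations a χ sel x k
  | 0 => h
  | k + 1 => (RespectsRelations.of_zero hsel h k).succ hsel

end Spline

/-- A finite sum of signs vanishes if each sign occurs at most once and the signs occur in pairs. -/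
theorem sum_eq_zero_of_signs {ι : Type*} {K : Finset ι} {s : ι → ℝ}
    (hs : ∀ i ∈ K, s i = 1 ∨ s i = -1) (hinj : ∀ i ∈ K, ∀ j ∈ K, s i = s j → i = j)
    (hopp : ∀ i ∈ K, ∃ j ∈ K, s j = - s i) : ∑ i ∈ K, s i = 0 := by
  classical
  choose! g hg hgs using hopp
  refine Finset.sum_involution (fun i _ => g i) (fun i hi => by rw [hgs i hi]; ring) ?_
    (fun i hi => hg i hi) ?_
  · intro i hi _ h
    have := hgs i hi
    rw [h] at this
    rcases hs i hi with h | h <;> rw [h] at this <;> norm_num at this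
  · intro i hi
    exact hinj _ (hg _ (hg i hi)) _ hi (by rw [hgs _ (hg i hi), hgs i hi, neg_neg])

theorem div_abs_eq_one_or {t : ℝ} (ht : t ≠ 0) : t / |t| = 1 ∨ t / |t| = -1 := by
  rcases abs_choice t with h | h <;> rw [h]
  · left; exact div_self ht
  · right; rw [div_neg, div_self ht]

theorem mul_pos_of_div_abs_eq {s t : ℝ} (hs : s ≠ 0) (ht : t ≠ 0) (h : s / |s| = t / |t|) :
    0 < s * t := by
  have hs' := abs_pos.2 hs
  have ht' := abs_pos.2 ht
  have h1 : s = t * (|s| / |t|) := by field_simp at h ⊢; linarith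
  rw [h1, mul_right_comm]
  have : 0 < t * t := mul_self_pos.2 ht
  positivity

theorem div_abs_eq_neg_of_mul_neg {s t : ℝ} (h : s * t < 0) : s / |s| = -(t / |t|) := by
  rcases mul_neg_iff.1 h with ⟨h1, h2⟩ | ⟨h1, h2⟩
  · rw [abs_of_pos h1, abs_of_neg h2, div_self h1.ne', div_neg, div_self h2.ne, neg_neg]
  · rw [abs_of_neg h1, abs_of_pos h2, div_neg, div_self h1.ne, div_self h2.ne']

/-! ### Degree zero: simplices containing a generic point -/

section Relations

variable {a : Fin n → Fin d → ℝ}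

/-- Apply to the relation the facet form of X∖{b,c}: only the terms of b and c survive. -/
theorem abs_mul_posDet_erase {X : Finset (Fin n)} {μ : Fin n → ℝ}
    (hμ : ∑ b ∈ X, μ b • lift (a b) = 0) {b c : Fin n} (hb : b ∈ X) (hc : c ∈ X) :
    |μ c| * posDet a (X.erase b) = |μ b| * posDet a (X.erase c) := by
  by_cases hbc : b = c
  · rw [hbc]
  have hcb : c ∈ X.erase b := Finset.mem_erase.2 ⟨fun h => hbc h.symm, hc⟩
  have hbc' : b ∈ X.erase c := Finset.mem_erase.2 ⟨hbc, hb⟩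
  have h0 : ∑ j ∈ X, μ j * facetForm a ((X.erase b).erase c) (lift (a j)) = 0 := by
    simpa using congrArg (facetForm a ((X.erase b).erase c)) hμ
  rw [← Finset.add_sum_erase X _ hb, ← Finset.add_sum_erase _ _ hcb, Finset.sum_eq_zero, add_zero]
    at h0
  · rw [posDet_eq_of_mem hcb, posDet_eq_of_mem hbc', Finset.erase_right_comm (a := c), ← abs_mul,
      ← abs_mul, eq_neg_of_add_eq_zero_left h0, abs_neg]
  · intro j hj
    rw [facetForm_lift_of_mem hj, mul_zero]

/-- A ratio test: the coefficients of y are moved along μ until the first one reaches zero. This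
happens at an index with μ < 0, which exists because the entries of μ sum to zero. -/
theorem exists_mem_hull_erase_of_pos {X : Finset (Fin n)} {μ : Fin n → ℝ}
    (hμ : ∑ b ∈ X, μ b • lift (a b) = 0) {b : Fin n} (hb : b ∈ X) (hμb : 0 < μ b)
    {y : Fin d → ℝ} (hy : y ∈ hull a (X.erase b)) :
    ∃ c ∈ X, μ c < 0 ∧ y ∈ hull a (X.erase c) := by
  obtain ⟨α, hα, hα0, hαy⟩ := mem_hull_iff.1 hy
  have hαb : α b = 0 := hα0 b (Finset.notMem_erase b X)
  have hαX : ∑ i ∈ X, α i • lift (a i) = lift y := by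
    rw [← Finset.add_sum_erase X _ hb, hαb, zero_smul, zero_add, hαy]
  have hneg : ∃ c ∈ X, μ c < 0 := by
    by_contra! h
    have := (sum_smul_lift_eq_zero.1 hμ).1
    have := (Finset.sum_eq_zero_iff_of_nonneg h).1 this b hb
    exact hμb.ne' this
  obtain ⟨c0, hc0, hμc0⟩ := hneg
  obtain ⟨c, hc, hmin⟩ := (X.filter fun c => μ c < 0).exists_min_image (fun c => α c / -μ c)
    ⟨c0, Finset.mem_filter.2 ⟨hc0, hμc0⟩⟩
  obtain ⟨hcX, hμc⟩ := Finset.mem_filter.1 hc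
  have ht : 0 ≤ α c / -μ c := div_nonneg (hα c) (by linarith)
  have hcz : α c + α c / -μ c * μ c = 0 := by
    have := hμc.ne
    field_simp
    ring
  refine ⟨c, hcX, hμc, mem_hull_iff.2
    ⟨fun i => if i ∈ X then α i + α c / -μ c * μ i else 0, fun i => ?_, fun i hi => ?_, ?_⟩⟩
  · beta_reduce
    by_cases hi : i ∈ X
    · rw [if_pos hi]
      by_cases h : μ i < 0
      · have h1 := hmin i (Finset.mem_filter.2 ⟨hi, h⟩)
        rw [le_div_iff₀ (by linarith)] at h1
        linarith
      · have := hα i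
        have := mul_nonneg ht (not_lt.1 h)
        linarith
    · rw [if_neg hi]
  · beta_reduce
    by_cases hiX : i ∈ X
    · have : i = c := by
        by_contra h
        exact hi (Finset.mem_erase.2 ⟨h, hiX⟩)
      rw [if_pos hiX, this, hcz]
    · rw [if_neg hiX]
  · have h1 : ∑ i ∈ X, (if i ∈ X then α i + α c / -μ c * μ i else 0) • lift (a i) = lift y := by
      rw [Finset.sum_congr rfl fun i hi => by rw [if_pos hi, add_smul, mul_smul],
        Finset.sum_add_distrib, ← Finset.smul_sum, hμ, smul_zero, add_zero, hαX]
    rw [← Finset.add_sum_erase X _ hcX, if_pos hcX, hcz, zero_smul, zero_add] at h1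
    exact h1

theorem exists_mem_hull_erase_of_ne_zero {X : Finset (Fin n)} {μ : Fin n → ℝ}
    (hμ : ∑ b ∈ X, μ b • lift (a b) = 0) {b : Fin n} (hb : b ∈ X) (hμb : μ b ≠ 0)
    {y : Fin d → ℝ} (hy : y ∈ hull a (X.erase b)) :
    ∃ c ∈ X, μ c * μ b < 0 ∧ y ∈ hull a (X.erase c) := by
  rcases lt_or_gt_of_ne hμb with h | h
  · obtain ⟨c, hc, hμc, hyc⟩ := exists_mem_hull_erase_of_pos (μ := fun i => -μ i)
      (by simp only [neg_smul, Finset.sum_neg_distrib, hμ, neg_zero]) hb (by simpa using h) hy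
    exact ⟨c, hc, mul_neg_of_pos_of_neg (by simpa using hμc) h, hyc⟩
  · obtain ⟨c, hc, hμc, hyc⟩ := exists_mem_hull_erase_of_pos hμ hb h hy
    exact ⟨c, hc, mul_neg_of_neg_of_pos hμc h, hyc⟩

/-- The point `y` is not in the convex hull of any `d` points of the configuration. -/
def IsGeneric (a : Fin n → Fin d → ℝ) (y : Fin d → ℝ) : Prop :=
  ∀ S : Finset (Fin n), S.card = d → y ∉ hull a S

/-- The relations on X form a line, so the two representations of y differ by tμ. From α_b = β_c = 0
one gets α_c β_b = −t² μ_b μ_c, which forces t = 0; then α_c = 0 and y lies in the hull of d points.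
-/
theorem IsGeneric.eq_of_mem_hull_erase {y : Fin d → ℝ} (hy : IsGeneric a y)
    {X : Finset (Fin n)} (hX : X.card = d + 2) {μ : Fin n → ℝ}
    (hμ : ∑ b ∈ X, μ b • lift (a b) = 0) {c₀ : Fin n} (hc₀ : c₀ ∈ X)
    (hB : IsBasis a (X.erase c₀)) (hμc₀ : μ c₀ ≠ 0) {b c : Fin n} (hb : b ∈ X) (hc : c ∈ X)
    (hbc : 0 < μ b * μ c) (hyb : y ∈ hull a (X.erase b)) (hyc : y ∈ hull a (X.erase c)) :
    b = c := by
  by_contra hne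
  obtain ⟨α, hα, hα0, hαy⟩ := mem_hull_iff.1 hyb
  obtain ⟨β, hβ, hβ0, hβy⟩ := mem_hull_iff.1 hyc
  have hαb : α b = 0 := hα0 b (Finset.notMem_erase b X)
  have hβc : β c = 0 := hβ0 c (Finset.notMem_erase c X)
  have hαX : ∑ i ∈ X, α i • lift (a i) = lift y := by
    rw [← Finset.add_sum_erase X _ hb, hαb, zero_smul, zero_add, hαy]
  have hβX : ∑ i ∈ X, β i • lift (a i) = lift y := by
    rw [← Finset.add_sum_erase X _ hc, hβc, zero_smul, zero_add, hβy]
  set t := (α c₀ - β c₀) / μ c₀ with ht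
  have hz : ∀ i ∈ X, α i - β i = t * μ i := by
    have h0 : α c₀ - β c₀ - t * μ c₀ = 0 := by rw [ht, div_mul_cancel₀ _ hμc₀, sub_self]
    have hs : ∑ i ∈ X, (α i - β i - t * μ i) • lift (a i) = 0 := by
      simp only [sub_smul, mul_smul, Finset.sum_sub_distrib, ← Finset.smul_sum, hμ, hαX, hβX]
      simp
    rw [← Finset.add_sum_erase X _ hc₀, h0, zero_smul, zero_add] at hs
    intro i hi
    by_cases hic : i = c₀
    · rw [hic]; linarith
    · linarith [hB.eq_zero_of_sum_eq_zero hs i (Finset.mem_erase.2 ⟨hic, hi⟩)]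
  have h1 := hz b hb
  have h2 := hz c hc
  rw [hαb] at h1
  rw [hβc] at h2
  have hαc := hα c
  have hβb := hβ b
  have hprod : α c * β b = -(t ^ 2 * (μ b * μ c)) := by
    have e1 : α c = t * μ c := by linarith
    have e2 : β b = -(t * μ b) := by linarith
    rw [e1, e2]; ring
  have ht0 : t = 0 := by
    by_contra h
    have : 0 < t ^ 2 * (μ b * μ c) := by positivity
    have := mul_nonneg hαc hβb
    linarith
  have hαc0 : α c = 0 := by rw [ht0] at h2; linarith
  have hcb : c ∈ X.erase b := Finset.mem_erase.2 ⟨fun h => hne h.symm, hc⟩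
  refine hy ((X.erase b).erase c) ?_ (mem_hull_iff.2 ⟨α, hα, fun i hi => ?_, ?_⟩)
  · rw [Finset.card_erase_of_mem hcb, Finset.card_erase_of_mem hb, hX]; rfl
  · by_cases hic : i = c
    · rw [hic, hαc0]
    · exact hα0 i fun h => hi (Finset.mem_erase.2 ⟨hic, h⟩)
  · rw [← Finset.add_sum_erase _ _ hcb, hαc0, zero_smul, zero_add] at hαy
    exact hαy

/-- The determinant of X∖b is proportional to |μ_b|, so each simplex containing y contributes a
common constant times the sign of μ_b. Only the indicators enter in degree 0, which is why they may
be evaluated at a point y other than x. -/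
theorem IsGeneric.respectsRelations {y x : Fin d → ℝ} (hy : IsGeneric a y)
    {χ : Finset (Fin n) → (Fin d → ℝ) → ℝ} (hχ : ∀ B, χ B x = closedInd a B y)
    (sel : Finset (Fin n) → Finset (Fin n)) : RespectsRelations a χ sel x 0 := by
  classical
  intro X μ hμ
  by_cases hex : ∃ c ∈ X, IsBasis a (X.erase c)
  swap
  · refine Finset.sum_eq_zero fun b hb => ?_
    rw [spline, if_neg fun h => hex ⟨b, hb, h⟩, mul_zero]
  obtain ⟨c, hc, hB⟩ := hex
  have hX : X.card = d + 2 := by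
    have := hB.1
    rw [Finset.card_erase_of_mem hc] at this
    omega
  by_cases hμc : μ c = 0
  · have hs := hμ
    rw [← Finset.add_sum_erase X _ hc, hμc, zero_smul, zero_add] at hs
    have hz := hB.eq_zero_of_sum_eq_zero hs
    refine Finset.sum_eq_zero fun b hb => ?_
    by_cases hbc : b = c
    · rw [hbc, hμc, zero_mul]
    · rw [hz b (Finset.mem_erase.2 ⟨hbc, hb⟩), zero_mul]
  have hdet := fun b (hb : b ∈ X) => abs_mul_posDet_erase hμ hb hc
  have hpos := hB.posDet_pos
  have hμc' := abs_pos.2 hμc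
  have hterm : ∀ b ∈ X, μ b * spline a χ sel 0 (X.erase b) x =
      if μ b ≠ 0 ∧ y ∈ hull a (X.erase b) then
        (d.factorial * |μ c| / posDet a (X.erase c)) * (μ b / |μ b|) else 0 := by
    intro b hb
    by_cases hμb : μ b = 0
    · simp [hμb]
    have hμb' := abs_pos.2 hμb
    have hb0 : posDet a (X.erase b) ≠ 0 := by
      intro h
      have h1 := hdet b hb
      rw [h, mul_zero] at h1
      exact (mul_pos hμb' hpos).ne h1
    rw [spline, if_pos (isBasis_iff_posDet.2 hb0), hχ, closedInd]
    by_cases hyb : y ∈ hull a (X.erase b)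
    · rw [Set.indicator_of_mem hyb, if_pos ⟨hμb, hyb⟩]
      have h1 := hdet b hb
      simp only [Pi.one_apply, mul_one]
      have h2 : posDet a (X.erase b) = |μ b| * posDet a (X.erase c) / |μ c| := by
        field_simp; linarith
      rw [h2]
      field_simp
    · rw [Set.indicator_of_notMem hyb, if_neg fun h => hyb h.2]; simp
  rw [Finset.sum_congr rfl hterm, ← Finset.sum_filter, ← Finset.mul_sum]
  refine mul_eq_zero_of_right _ (sum_eq_zero_of_signs ?_ ?_ ?_)
  · intro b hb
    exact div_abs_eq_one_or (Finset.mem_filter.1 hb).2.1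
  · intro b hb b' hb' h
    obtain ⟨h1, h2, h3⟩ := Finset.mem_filter.1 hb
    obtain ⟨h1', h2', h3'⟩ := Finset.mem_filter.1 hb'
    exact hy.eq_of_mem_hull_erase hX hμ hc hB hμc h1 h1' (mul_pos_of_div_abs_eq h2 h2' h) h3 h3'
  · intro b hb
    obtain ⟨h1, h2, h3⟩ := Finset.mem_filter.1 hb
    obtain ⟨b', hb', hneg, hyb'⟩ := exists_mem_hull_erase_of_ne_zero hμ h1 h2 h3
    refine ⟨b', Finset.mem_filter.2 ⟨hb', ?_, hyb'⟩, div_abs_eq_neg_of_mul_neg hneg⟩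
    rintro h0
    rw [h0, zero_mul] at hneg
    exact lt_irrefl _ hneg

theorem hull_isClosed (a : Fin n → Fin d → ℝ) (S : Finset (Fin n)) : IsClosed (hull a S) := by
  have : (a '' (S : Set (Fin n))).Finite := S.finite_toSet.image a
  exact this.isClosed_convexHull ℝ

theorem tendsto_segment (x p : Fin d → ℝ) :
    Filter.Tendsto (fun t : ℝ => x + t • (p - x)) (𝓝[>] 0) (𝓝 x) := by
  have : Filter.Tendsto (fun t : ℝ => x + t • (p - x)) (𝓝 0) (𝓝 (x + (0 : ℝ) • (p - x))) :=
    (Continuous.tendsto (by fun_prop) 0)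
  rw [zero_smul, add_zero] at this
  exact this.mono_left nhdsWithin_le_nhds

theorem mem_hull_of_frequently {S : Finset (Fin n)} {x p : Fin d → ℝ}
    (h : ∃ᶠ t in 𝓝[>] (0 : ℝ), x + t • (p - x) ∈ hull a S) : x ∈ hull a S :=
  (hull_isClosed a S).mem_of_frequently_of_tendsto h (tendsto_segment x p)

theorem mem_hull_of_halfOpenInd_ne_zero {S : Finset (Fin n)} {x p : Fin d → ℝ}
    (h : halfOpenInd a p S x ≠ 0) : x ∈ hull a S := by
  have : x ∈ {x | ∀ᶠ t in 𝓝[>] (0 : ℝ), x + t • (p - x) ∈ hull a S} := by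
    by_contra hx
    exact h (Set.indicator_of_notMem hx _)
  exact mem_hull_of_frequently (Filter.Eventually.frequently this)

/-- If the segment meets the hull at arbitrarily small t, then x is in the hull by closedness, and
by convexity so is a whole initial piece. Membership is therefore eventually constant. -/
theorem eventually_halfOpenInd_eq (S : Finset (Fin n)) (x p : Fin d → ℝ) :
    ∀ᶠ t in 𝓝[>] (0 : ℝ), halfOpenInd a p S x = closedInd a S (x + t • (p - x)) := by
  by_cases h : ∀ᶠ t in 𝓝[>] (0 : ℝ), x + t • (p - x) ∈ hull a S
  · filter_upwards [h] with t ht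
    rw [halfOpenInd, closedInd, Set.indicator_of_mem (by exact h), Set.indicator_of_mem ht]
    rfl
  · have hno : ∀ᶠ t in 𝓝[>] (0 : ℝ), x + t • (p - x) ∉ hull a S := by
      by_contra hf
      have hf' : ∃ᶠ t in 𝓝[>] (0 : ℝ), x + t • (p - x) ∈ hull a S := hf
      refine h ?_
      have hx := mem_hull_of_frequently hf'
      obtain ⟨t₀, ht₀, hpos⟩ := (hf'.and_eventually self_mem_nhdsWithin).exists
      filter_upwards [Ioo_mem_nhdsGT (show (0 : ℝ) < t₀ from hpos)] with t ht
      have hconv := (convex_convexHull ℝ (a '' (S : Set (Fin n)))).add_smul_sub_mem hx ht₀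
        (t := t / t₀) ⟨by have := ht.1; have : 0 < t₀ := hpos; positivity,
          (div_le_one (show (0 : ℝ) < t₀ from hpos)).2 ht.2.le⟩
      rwa [add_sub_cancel_left, smul_smul, div_mul_cancel₀ _ (ne_of_gt hpos)] at hconv
    filter_upwards [hno] with t ht
    rw [halfOpenInd, closedInd, Set.indicator_of_notMem (by exact h), Set.indicator_of_notMem ht]

/-- If the ray from x met one of these affine spans at two parameters, the span would contain the
whole line and hence p. -/
theorem eventually_isGeneric {x p : Fin d → ℝ}
    (hp : ∀ S : Finset (Fin n), S.card = d → p ∉ affineSpan ℝ (a '' (S : Set (Fin n)))) :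
    ∀ᶠ t in 𝓝[>] (0 : ℝ), IsGeneric a (x + t • (p - x)) := by
  unfold IsGeneric
  rw [Filter.eventually_all]
  intro S
  rw [Filter.eventually_imp_distrib_left]
  intro hS
  set L := affineSpan ℝ (a '' (S : Set (Fin n)))
  have hsub : hull a S ⊆ L := convexHull_subset_affineSpan _
  by_cases h : ∃ t₀ > (0 : ℝ), x + t₀ • (p - x) ∈ L
  · obtain ⟨t₀, ht₀, hmem⟩ := h
    filter_upwards [Ioo_mem_nhdsGT ht₀] with t ht hmem'
    refine hp S hS ?_
    have hne : t₀ - t ≠ 0 := by have := ht.2; linarith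
    -- The parameter s solves t + s(t₀ − t) = 1, the value at which the ray reaches p.
    have := AffineMap.lineMap_mem ((1 - t) / (t₀ - t)) (hsub hmem') hmem
    convert this using 1
    rw [AffineMap.lineMap_apply, vsub_eq_sub, vadd_eq_add]
    funext j
    simp
    field_simp
    ring
  · filter_upwards [self_mem_nhdsWithin] with t ht hmem'
    exact h ⟨t, ht, hsub hmem'⟩

theorem exists_generic_model {x p : Fin d → ℝ} (hx : x ∈ hull a Finset.univ)
    (hpA : p ∈ hull a Finset.univ)
    (hp : ∀ S : Finset (Fin n), S.card = d → p ∉ affineSpan ℝ (a '' (S : Set (Fin n)))) :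
    ∃ y ∈ hull a Finset.univ, IsGeneric a y ∧ ∀ B, halfOpenInd a p B x = closedInd a B y := by
  have h1 : ∀ᶠ t in 𝓝[>] (0 : ℝ), ∀ S : Finset (Fin n),
      halfOpenInd a p S x = closedInd a S (x + t • (p - x)) :=
    Filter.eventually_all.2 fun S => eventually_halfOpenInd_eq S x p
  obtain ⟨t, ⟨h1, h2⟩, h3⟩ := ((h1.and (eventually_isGeneric hp)).and
    (Ioo_mem_nhdsGT (show (0 : ℝ) < 1 by norm_num))).exists
  refine ⟨x + t • (p - x), ?_, h2, h1⟩
  exact (convex_convexHull ℝ _).add_smul_sub_mem hx hpA ⟨h3.1.le, h3.2.le⟩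

end Relations

/-! ### Tiles on the two sides of a facet -/

section Tiling

variable {a : Fin n → Fin d → ℝ} {P : Finset (Finset (Fin n) × Finset (Fin n))}
  {T T' F : Finset (Fin n) × Finset (Fin n)} {J C : Finset (Fin n)} {b b' : Fin n}

theorem map_lift_nonneg_of_mem_hull {S : Finset (Fin n)} {x : Fin d → ℝ} (hx : x ∈ hull a S)
    (f : (Fin (d + 1) → ℝ) →ₗ[ℝ] ℝ) (hf : ∀ i ∈ S, 0 ≤ f (lift (a i))) : 0 ≤ f (lift x) := by
  obtain ⟨w, hw, -, hwx⟩ := mem_hull_iff.1 hx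
  rw [← hwx, map_sum]
  refine Finset.sum_nonneg fun i hi => ?_
  rw [map_smul, smul_eq_mul]
  exact mul_nonneg (hw i) (hf i hi)

theorem mem_tile_iff (hB : IsBasis a T.2) {z : Fin (d + 1) → ℝ} :
    z ∈ tile a T ↔ ∀ b ∈ T.2,
      coordForm a T.2 b (z - ∑ i ∈ T.1, lift (a i)) ∈ Set.Icc (0 : ℝ) 1 := by
  constructor
  · rintro ⟨α, hα, rfl⟩ b hb
    rw [add_sub_cancel_left, hB.coordForm_sum hb subset_rfl, if_pos hb]
    exact hα b
  · intro h
    refine ⟨fun b => if b ∈ T.2 then coordForm a T.2 b (z - ∑ i ∈ T.1, lift (a i)) else 0,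
      fun b => ?_, ?_⟩
    · beta_reduce
      split_ifs with hb
      · exact h b hb
      · simp
    · have e : ∑ b ∈ T.2, (if b ∈ T.2 then coordForm a T.2 b (z - ∑ i ∈ T.1, lift (a i)) else 0) •
          lift (a b) = z - ∑ i ∈ T.1, lift (a i) :=
        (Finset.sum_congr rfl fun b hb => by rw [if_pos hb]).trans (hB.sum_coordForm _)
      beta_reduce
      rw [e, add_sub_cancel]

theorem coordForm_of_mem_face (hB : IsBasis a T.2) (hd : Disjoint T.1 T.2) (hF : IsFace F T)
    {z : Fin (d + 1) → ℝ} (hz : z ∈ tile a F) (hb : b ∈ T.2) (hbF : b ∉ F.2) :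
    coordForm a T.2 b (z - ∑ i ∈ T.1, lift (a i)) = if b ∈ F.1 then 1 else 0 := by
  obtain ⟨α, -, rfl⟩ := hz
  obtain ⟨h1, h2, h3⟩ := hF
  have hsub : F.1 \ T.1 ⊆ T.2 := by
    intro i hi
    obtain ⟨hi1, hi2⟩ := Finset.mem_sdiff.1 hi
    rcases Finset.mem_union.1 (h3 hi1) with h | h
    · exact absurd h hi2
    · exact (Finset.mem_sdiff.1 h).1
  have e : ∑ i ∈ F.1, lift (a i) + ∑ b ∈ F.2, α b • lift (a b) - ∑ i ∈ T.1, lift (a i) =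
      ∑ i ∈ F.1 \ T.1, (fun _ => (1 : ℝ)) i • lift (a i) + ∑ b ∈ F.2, α b • lift (a b) := by
    rw [← Finset.sum_sdiff h2]
    simp only [one_smul]
    abel
  rw [e, map_add, hB.coordForm_sum hb hsub, hB.coordForm_sum hb h1, if_neg hbF, add_zero]
  have : b ∉ T.1 := fun h => Finset.disjoint_left.1 hd h hb
  simp [this]

theorem IsFace.fst_eq (hF : IsFace F T) (h : F.2 = T.2) : F.1 = T.1 := by
  obtain ⟨-, h2, h3⟩ := hF
  rw [h, Finset.sdiff_self, Finset.union_empty] at h3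
  exact h3.antisymm h2

theorem IsFace.eq_of_snd_eq (hF : IsFace F T) (hF' : IsFace F T') (hB : IsBasis a T.2)
    (hB' : IsBasis a T'.2) (h : F.2 = T.2) : T = T' := by
  have h' : F.2 = T'.2 := Finset.eq_of_subset_of_card_le hF'.1 (by rw [h, hB.1, hB'.1])
  exact Prod.ext ((hF.fst_eq h).symm.trans (hF'.fst_eq h')) (h.symm.trans h')

theorem IsFineZonotopalTiling.exists_face (hP : IsFineZonotopalTiling a P) (hT : T ∈ P)
    (hT' : T' ∈ P) {z : Fin (d + 1) → ℝ} (hz : z ∈ tile a T) (hz' : z ∈ tile a T') :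
    ∃ F, IsFace F T ∧ IsFace F T' ∧ z ∈ tile a F := by
  rcases hP.inter T hT T' hT' with h | ⟨F, h1, h2, h3⟩
  · exact absurd (show z ∈ tile a T ∩ tile a T' from ⟨hz, hz'⟩) (by rw [h]; simp)
  · exact ⟨F, h1, h2, h3 ▸ ⟨hz, hz'⟩⟩

/-- A proper face fixes some coordinate at 0 or 1, so a common face through an interior point is the
whole tile, label included. -/
theorem IsFineZonotopalTiling.eq_of_interior (hP : IsFineZonotopalTiling a P) (hT : T ∈ P)
    (hT' : T' ∈ P) {z : Fin (d + 1) → ℝ}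
    (hz : ∀ b ∈ T.2, coordForm a T.2 b (z - ∑ i ∈ T.1, lift (a i)) ∈ Set.Ioo (0 : ℝ) 1)
    (hz' : z ∈ tile a T') : T = T' := by
  have hB := hP.basis T hT
  obtain ⟨F, h1, h2, h3⟩ := hP.exists_face hT hT'
    ((mem_tile_iff hB).2 fun b hb => Set.Ioo_subset_Icc_self (hz b hb)) hz'
  refine h1.eq_of_snd_eq h2 hB (hP.basis T' hT') (h1.1.antisymm fun b hb => ?_)
  by_contra hbF
  have e := coordForm_of_mem_face hB (hP.disjoint T hT) h1 h3 hb hbF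
  have := hz b hb
  rw [e] at this
  split_ifs at this
  · exact lt_irrefl _ this.2
  · exact lt_irrefl _ this.1

/-- The labelled set `Π_{J,C}` is the facet of the tile `T` obtained by fixing the coefficient of
`v_b`. -/
def IsIncident (J C : Finset (Fin n)) (T : Finset (Fin n) × Finset (Fin n)) (b : Fin n) : Prop :=
  b ∈ T.2 ∧ T.2.erase b = C ∧ (T.1 = J ∨ insert b T.1 = J)

/-- The vector `± v_b` pointing from the facet `Π_{J,C}` into the tile incident to it. -/
def inward (a : Fin n → Fin d → ℝ) (J : Finset (Fin n)) (b : Fin n) : Fin (d + 1) → ℝ :=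
  if b ∈ J then -lift (a b) else lift (a b)

/-- The barycentre of `Π_{J,C}`. -/
def barycentre (a : Fin n → Fin d → ℝ) (J C : Finset (Fin n)) : Fin (d + 1) → ℝ :=
  ∑ i ∈ J, lift (a i) + ∑ c ∈ C, (1 / 2 : ℝ) • lift (a c)

namespace IsIncident

theorem isFace (h : IsIncident J C T b) : IsFace (J, C) T := by
  obtain ⟨hb, rfl, h⟩ := h
  refine ⟨Finset.erase_subset _ _, ?_, ?_⟩
  · rcases h with rfl | rfl
    · exact subset_rfl
    · exact Finset.subset_insert _ _
  · rcases h with rfl | rfl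
    · exact Finset.subset_union_left
    · intro i hi
      rcases Finset.mem_insert.1 hi with rfl | hi
      · simp [hb]
      · simp [hi]

theorem disjoint (h : IsIncident J C T b) (hd : Disjoint T.1 T.2) : Disjoint J C := by
  obtain ⟨hb, rfl, h⟩ := h
  have h0 : Disjoint T.1 (T.2.erase b) := hd.mono_right (Finset.erase_subset _ _)
  rcases h with rfl | rfl
  · exact h0
  · exact Finset.disjoint_insert_left.2 ⟨Finset.notMem_erase _ _, h0⟩

theorem coordForm_barycentre (h : IsIncident J C T b) (hB : IsBasis a T.2)
    (hd : Disjoint T.1 T.2) {c : Fin n} (hc : c ∈ T.2) :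
    coordForm a T.2 c (barycentre a J C - ∑ i ∈ T.1, lift (a i)) =
      if c = b then (if b ∈ J then 1 else 0) else 1 / 2 := by
  obtain ⟨hb, rfl, h⟩ := h
  have hbT : b ∉ T.1 := fun h => Finset.disjoint_left.1 hd h hb
  have e : barycentre a J (T.2.erase b) - ∑ i ∈ T.1, lift (a i) =
      ∑ i ∈ T.2, (fun c => if c = b then (if b ∈ J then (1 : ℝ) else 0) else 1 / 2) i •
        lift (a i) := by
    rw [← Finset.add_sum_erase _ _ hb]
    have : ∀ i ∈ T.2.erase b,
        (fun c => if c = b then (if b ∈ J then (1 : ℝ) else 0) else 1 / 2) i • lift (a i) =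
          (1 / 2 : ℝ) • lift (a i) := fun i hi => by
      beta_reduce
      rw [if_neg (Finset.ne_of_mem_erase hi)]
    rw [Finset.sum_congr rfl this, barycentre]
    rcases h with rfl | rfl
    · simp [hbT]
    · rw [Finset.sum_insert hbT]
      simp
      abel
  rw [e, hB.coordForm_sum hc subset_rfl, if_pos hc]

theorem facetForm_ne_zero (h : IsIncident J C T b) (hB : IsBasis a T.2) :
    facetForm a C (inward a J b) ≠ 0 := by
  obtain ⟨hb, rfl, -⟩ := h
  have := hB.facetForm_ne_zero hb
  unfold inward
  split_ifs
  · rwa [map_neg, neg_ne_zero]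
  · exact this

theorem coordForm_pos (h : IsIncident J C T b) {w : Fin (d + 1) → ℝ}
    (hw : 0 < facetForm a C (inward a J b) * facetForm a C w) (hbJ : b ∉ J) :
    0 < coordForm a T.2 b w := by
  obtain ⟨hb, rfl, -⟩ := h
  rw [inward, if_neg hbJ] at hw
  rw [coordForm_apply]
  rcases mul_pos_iff.1 hw with ⟨h1, h2⟩ | ⟨h1, h2⟩
  · exact div_pos h2 h1
  · exact div_pos_of_neg_of_neg h2 h1

theorem coordForm_neg (h : IsIncident J C T b) {w : Fin (d + 1) → ℝ}
    (hw : 0 < facetForm a C (inward a J b) * facetForm a C w) (hbJ : b ∈ J) :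
    coordForm a T.2 b w < 0 := by
  obtain ⟨hb, rfl, -⟩ := h
  rw [inward, if_pos hbJ, map_neg] at hw
  rw [coordForm_apply]
  rcases mul_pos_iff.1 hw with ⟨h1, h2⟩ | ⟨h1, h2⟩
  · exact div_neg_of_pos_of_neg h2 (by linarith)
  · exact div_neg_of_neg_of_pos h2 (by linarith)

end IsIncident

theorem eventually_add_mul_pos {p q : ℝ} (h : 0 < p ∨ p = 0 ∧ 0 < q) :
    ∀ᶠ t in 𝓝[>] (0 : ℝ), 0 < p + t * q := by
  rcases h with h | ⟨rfl, h⟩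
  · have : Filter.Tendsto (fun t : ℝ => p + t * q) (𝓝 0) (𝓝 (p + 0 * q)) :=
      Continuous.tendsto (by fun_prop) 0
    rw [zero_mul, add_zero] at this
    exact (this.mono_left nhdsWithin_le_nhds).eventually_const_lt h
  · filter_upwards [self_mem_nhdsWithin] with t ht
    have : 0 < t := ht
    positivity

/-- At the barycentre all coordinates are 1/2 except that of b, which is 0 or 1 and moves inward
along w. -/
theorem IsIncident.eventually_interior (h : IsIncident J C T b) (hB : IsBasis a T.2)
    (hd : Disjoint T.1 T.2) {w : Fin (d + 1) → ℝ}
    (hw : 0 < facetForm a C (inward a J b) * facetForm a C w) :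
    ∀ᶠ t in 𝓝[>] (0 : ℝ), ∀ c ∈ T.2,
      coordForm a T.2 c (barycentre a J C + t • w - ∑ i ∈ T.1, lift (a i)) ∈
        Set.Ioo (0 : ℝ) 1 := by
  rw [Filter.eventually_all_finset]
  intro c hc
  have e : ∀ t : ℝ, coordForm a T.2 c (barycentre a J C + t • w - ∑ i ∈ T.1, lift (a i)) =
      (if c = b then (if b ∈ J then 1 else 0) else 1 / 2) + t * coordForm a T.2 c w := by
    intro t
    rw [add_sub_right_comm, map_add, h.coordForm_barycentre hB hd hc, map_smul, smul_eq_mul]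
  simp only [e]
  set p : ℝ := if c = b then (if b ∈ J then 1 else 0) else 1 / 2 with hp
  set q := coordForm a T.2 c w with hq
  have h1 : 0 < p ∨ p = 0 ∧ 0 < q := by
    by_cases hcb : c = b
    · by_cases hbJ : b ∈ J
      · left; simp [hp, hcb, hbJ]
      · right
        refine ⟨by simp [hp, hcb, hbJ], ?_⟩
        rw [hq, hcb]; exact h.coordForm_pos hw hbJ
    · left; simp [hp, hcb]
  have h2 : 0 < 1 - p ∨ 1 - p = 0 ∧ 0 < -q := by
    by_cases hcb : c = b
    · by_cases hbJ : b ∈ J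
      · right
        refine ⟨by simp [hp, hcb, hbJ], ?_⟩
        rw [hq, hcb]; exact neg_pos.2 (h.coordForm_neg hw hbJ)
      · left; simp [hp, hcb, hbJ]
    · left; simp only [hp, hcb, if_false]; norm_num
  filter_upwards [eventually_add_mul_pos h1, eventually_add_mul_pos h2] with t ht1 ht2
  exact ⟨ht1, by linarith⟩

/-- Two tiles on the same side of the facet would share interior points near its barycentre. -/
theorem IsFineZonotopalTiling.incident_unique (hP : IsFineZonotopalTiling a P) (hT : T ∈ P)
    (hT' : T' ∈ P) (h : IsIncident J C T b) (h' : IsIncident J C T' b')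
    (hs : 0 < facetForm a C (inward a J b) * facetForm a C (inward a J b')) :
    T = T' ∧ b = b' := by
  have h0 := h.facetForm_ne_zero (hP.basis T hT)
  obtain ⟨t, h1, h2⟩ := ((h.eventually_interior (hP.basis T hT) (hP.disjoint T hT)
    (mul_self_pos.2 h0)).and (h'.eventually_interior (hP.basis T' hT') (hP.disjoint T' hT')
    (w := inward a J b) (by rwa [mul_comm]))).exists
  have e : T = T' := hP.eq_of_interior hT hT' h1
    ((mem_tile_iff (hP.basis T' hT')).2 fun c hc => Set.Ioo_subset_Icc_self (h2 c hc))
  refine ⟨e, ?_⟩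
  subst e
  by_contra hne
  have := Finset.mem_erase.2 ⟨hne, h.1⟩
  rw [h'.2.1, ← h.2.1] at this
  exact Finset.notMem_erase _ _ this

theorem isClosed_tile (hB : IsBasis a T.2) : IsClosed (tile a T) := by
  have : tile a T = ⋂ b ∈ T.2, (fun z => coordForm a T.2 b (z - ∑ i ∈ T.1, lift (a i))) ⁻¹'
      Set.Icc (0 : ℝ) 1 := by
    ext z
    simp only [mem_tile_iff hB, Set.mem_iInter, Set.mem_preimage]
  rw [this]
  refine isClosed_biInter fun b _ => isClosed_Icc.preimage ?_
  exact (coordForm a T.2 b).continuous_of_finiteDimensional.comp (by fun_prop)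

/-- Some tile T' contains points across the facet arbitrarily near its barycentre, hence the
barycentre itself. The common face of T and T' is then proper and meets the relative interior of
Π_{J,C}, so it is Π_{J,C} with the same label. -/
theorem IsFineZonotopalTiling.exists_incident (hP : IsFineZonotopalTiling a P) (hT : T ∈ P)
    (h : IsIncident J C T b) {w : Fin (d + 1) → ℝ}
    (hw : facetForm a C (inward a J b) * facetForm a C w < 0)
    (hZ : ∀ᶠ t in 𝓝[>] (0 : ℝ), barycentre a J C + t • w ∈ zonotope a) :
    ∃ T' ∈ P, ∃ b', IsIncident J C T' b' ∧
      0 < facetForm a C (inward a J b') * facetForm a C w := by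
  have hB := hP.basis T hT
  have hd := hP.disjoint T hT
  -- There are finitely many tiles, so one of them is met at arbitrarily small t.
  obtain ⟨T', hT', hfreq⟩ : ∃ T' ∈ P, ∃ᶠ t in 𝓝[>] (0 : ℝ),
      barycentre a J C + t • w ∈ tile a T' := by
    by_contra! hcon
    have h1 : ∀ᶠ t in 𝓝[>] (0 : ℝ), ∀ T' ∈ P, barycentre a J C + t • w ∉ tile a T' :=
      (Filter.eventually_all_finset P).2 fun T' hT' => hcon T' hT'
    obtain ⟨t, h2, h3⟩ := (hZ.and h1).exists
    rw [← hP.cover, Set.mem_iUnion₂] at h2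
    obtain ⟨T', hT', h4⟩ := h2
    exact h3 T' hT' h4
  have hB' := hP.basis T' hT'
  have hd' := hP.disjoint T' hT'
  have hlim : Filter.Tendsto (fun t : ℝ => barycentre a J C + t • w) (𝓝[>] 0)
      (𝓝 (barycentre a J C)) := by
    have : Filter.Tendsto (fun t : ℝ => barycentre a J C + t • w) (𝓝 0)
        (𝓝 (barycentre a J C + (0 : ℝ) • w)) := Continuous.tendsto (by fun_prop) 0
    rw [zero_smul, add_zero] at this
    exact this.mono_left nhdsWithin_le_nhds
  have hz' : barycentre a J C ∈ tile a T' := (isClosed_tile hB').mem_of_frequently_of_tendsto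
    hfreq hlim
  have hz : barycentre a J C ∈ tile a T := by
    rw [mem_tile_iff hB]
    intro c hc
    rw [h.coordForm_barycentre hB hd hc]
    split_ifs <;> norm_num
  have hcoord : ∀ (T : Finset (Fin n) × Finset (Fin n)) (b : Fin n), IsIncident J C T b →
      IsBasis a T.2 → Disjoint T.1 T.2 → ∀ t : ℝ,
      coordForm a T.2 b (barycentre a J C + t • w - ∑ i ∈ T.1, lift (a i)) =
      (if b ∈ J then 1 else 0) + t * coordForm a T.2 b w := by
    intro T b h hB hd t
    rw [add_sub_right_comm, map_add, h.coordForm_barycentre hB hd h.1, map_smul, smul_eq_mul,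
      if_pos rfl]
  -- If w points out of an incident tile, the coordinate of b leaves [0,1] at once, so that tile is
  -- not met for t > 0.
  have hside : ∀ (T : Finset (Fin n) × Finset (Fin n)) (b : Fin n), IsIncident J C T b →
      IsBasis a T.2 → Disjoint T.1 T.2 →
      (∃ᶠ t in 𝓝[>] (0 : ℝ), barycentre a J C + t • w ∈ tile a T) →
      ¬ facetForm a C (inward a J b) * facetForm a C w < 0 := by
    intro T b h hB hd hfreq hneg
    have hneg' : 0 < facetForm a C (inward a J b) * facetForm a C (-w) := by
      rw [map_neg, mul_neg]; linarith
    obtain ⟨t, ht, ht0⟩ := (hfreq.and_eventually self_mem_nhdsWithin).exists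
    have ht0 : 0 < t := ht0
    have h1 := (mem_tile_iff hB).1 ht b h.1
    rw [hcoord T b h hB hd t] at h1
    by_cases hbJ : b ∈ J
    · have h2 := h.coordForm_neg hneg' hbJ
      rw [map_neg] at h2
      rw [if_pos hbJ] at h1
      have := mul_pos ht0 (show 0 < coordForm a T.2 b w by linarith)
      linarith [h1.2]
    · have h2 := h.coordForm_pos hneg' hbJ
      rw [map_neg] at h2
      rw [if_neg hbJ] at h1
      have := mul_pos ht0 (show 0 < -coordForm a T.2 b w from h2)
      linarith [h1.1]
  have hne : T ≠ T' := by
    rintro rfl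
    exact hside T b h hB hd hfreq hw
  obtain ⟨F, hF, hF', hzF⟩ := hP.exists_face hT hT' hz hz'
  have hF2 : F.2 ≠ T.2 := fun e => hne (hF.eq_of_snd_eq hF' hB hB' e)
  -- The barycentre has coordinate 1/2 along each c in C, while a face without direction c pins that
  -- coordinate to 0 or 1.
  have hCF : C ⊆ F.2 := by
    intro c hc
    by_contra hcF
    have hc' : c ∈ T.2.erase b := by rw [h.2.1]; exact hc
    have hcT := Finset.mem_of_mem_erase hc'
    have h1 := coordForm_of_mem_face hB hd hF hzF hcT hcF
    rw [h.coordForm_barycentre hB hd hcT, if_neg (Finset.ne_of_mem_erase hc')] at h1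
    split_ifs at h1 <;> norm_num at h1
  have hbF : b ∉ F.2 := by
    intro hbF
    refine hF2 (hF.1.antisymm fun c hc => ?_)
    by_cases hcb : c = b
    · rw [hcb]; exact hbF
    · apply hCF; rw [← h.2.1]; exact Finset.mem_erase.2 ⟨hcb, hc⟩
  have hF2C : F.2 = C := by
    refine Finset.Subset.antisymm (fun c hc => ?_) hCF
    rw [← h.2.1]
    exact Finset.mem_erase.2 ⟨fun e => hbF (e ▸ hc), hF.1 hc⟩
  have hbJ : b ∈ F.1 ↔ b ∈ J := by
    have h1 := coordForm_of_mem_face hB hd hF hzF h.1 hbF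
    rw [h.coordForm_barycentre hB hd h.1, if_pos rfl] at h1
    by_cases h2 : b ∈ J <;> by_cases h3 : b ∈ F.1 <;> simp_all
  have hF1 : F.1 = J := by
    have hJ := h.isFace
    have haux : ∀ G : Finset (Fin n) × Finset (Fin n), IsFace G T → G.2 = C → ∀ i, i ≠ b →
        (i ∈ G.1 ↔ i ∈ T.1) := by
      intro G hG hGC i hi
      refine ⟨fun hiG => ?_, fun hiT => hG.2.1 hiT⟩
      rcases Finset.mem_union.1 (hG.2.2 hiG) with h1 | h1
      · exact h1
      · rw [hGC, ← h.2.1] at h1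
        obtain ⟨h2, h3⟩ := Finset.mem_sdiff.1 h1
        exact absurd (Finset.mem_erase.2 ⟨hi, h2⟩) h3
    ext i
    by_cases hi : i = b
    · rw [hi]; exact hbJ
    · rw [haux F hF hF2C i hi, ← haux (J, C) hJ rfl i hi]
  have hF'' : IsFace (J, C) T' := by
    have : F = (J, C) := Prod.ext hF1 hF2C
    rwa [this] at hF'
  have hcard : (T'.2 \ C).card = 1 := by
    rw [Finset.card_sdiff_of_subset hF''.1, hB'.1, ← h.2.1, Finset.card_erase_of_mem h.1, hB.1]
    omega
  obtain ⟨b', hb'⟩ := Finset.card_eq_one.1 hcard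
  have hb'T : b' ∈ T'.2 \ C := by rw [hb']; simp
  obtain ⟨hb'1, hb'2⟩ := Finset.mem_sdiff.1 hb'T
  have hinc : IsIncident J C T' b' := by
    refine ⟨hb'1, ?_, ?_⟩
    · ext i
      rw [Finset.mem_erase]
      constructor
      · rintro ⟨h1, h2⟩
        by_contra h3
        have : i ∈ T'.2 \ C := Finset.mem_sdiff.2 ⟨h2, h3⟩
        rw [hb'] at this
        exact h1 (Finset.mem_singleton.1 this)
      · intro hi
        exact ⟨fun e => hb'2 (e ▸ hi), hF''.1 hi⟩
    · have h1 := hF''.2.1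
      have h2 := hF''.2.2
      simp only [hb'] at h1 h2
      by_cases hbJ' : b' ∈ J
      · right
        refine Finset.Subset.antisymm (Finset.insert_subset hbJ' h1) fun i hi => ?_
        have := h2 hi
        simp only [Finset.mem_union, Finset.mem_singleton] at this
        rw [Finset.mem_insert]
        tauto
      · left
        refine Finset.Subset.antisymm h1 fun i hi => ?_
        have := h2 hi
        simp only [Finset.mem_union, Finset.mem_singleton] at this
        rcases this with h | rfl
        · exact h
        · exact absurd hi hbJ'
  refine ⟨T', hT', b', hinc, lt_of_le_of_ne (not_lt.1 (hside T' b' hinc hB' hd' hfreq)) ?_⟩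
  refine (mul_ne_zero (hinc.facetForm_ne_zero hB') ?_).symm
  rintro h0
  rw [h0, mul_zero] at hw
  exact lt_irrefl _ hw

/-- Outside C the barycentre uses coefficient 1 on J and 0 elsewhere, which leaves room to decrease
or increase it respectively. -/
theorem eventually_barycentre_add_mem_zonotope (hJC : Disjoint J C) {i : Fin n} {τ : ℝ}
    (hi : i ∉ C) (hτ : i ∈ J ∧ τ = -1 ∨ i ∉ J ∧ τ = 1) :
    ∀ᶠ t in 𝓝[>] (0 : ℝ), barycentre a J C + t • τ • lift (a i) ∈ zonotope a := by
  filter_upwards [Ioo_mem_nhdsGT (show (0 : ℝ) < 1 by norm_num)] with t ht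
  refine ⟨fun j => (if j ∈ J then 1 else 0) + (if j ∈ C then 1 / 2 else 0) +
    (if j = i then t * τ else 0), fun j => ?_, ?_⟩
  · beta_reduce
    obtain ⟨ht0, ht1⟩ := ht
    by_cases hji : j = i
    · subst hji
      rcases hτ with ⟨h1, h2⟩ | ⟨h1, h2⟩ <;> simp only [h1, h2, hi, if_true, if_false] <;>
        constructor <;> linarith
    · by_cases hjJ : j ∈ J
      · have : j ∉ C := Finset.disjoint_left.1 hJC hjJ
        simp [hji, hjJ, this]
      · by_cases hjC : j ∈ C
        · simp only [hji, hjJ, hjC, if_true, if_false]; constructor <;> norm_num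
        · simp [hji, hjJ, hjC]
  · simp only [add_smul, Finset.sum_add_distrib, ite_smul, zero_smul, one_smul]
    simp [barycentre, mul_smul]

end Tiling

/-! ### Cancellation at facets and the triangulation at level zero -/

section Balance

variable {a : Fin n → Fin d → ℝ} {P : Finset (Finset (Fin n) × Finset (Fin n))}

open Classical in
/-- The pairs `(T, b)` for which `Π_{J,C}` is the facet of the tile `T` in direction `v_b`. -/
def incidences (P : Finset (Finset (Fin n) × Finset (Fin n))) (J C : Finset (Fin n)) :
    Finset ((Finset (Fin n) × Finset (Fin n)) × Fin n) :=
  (P ×ˢ Finset.univ).filter fun p => IsIncident J C p.1 p.2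

theorem mem_incidences {J C : Finset (Fin n)} {p : (Finset (Fin n) × Finset (Fin n)) × Fin n} :
    p ∈ incidences P J C ↔ p.1 ∈ P ∧ IsIncident J C p.1 p.2 := by
  simp [incidences]

/-- The contributions of the tiles incident to a facet cancel, unless the facet lies in the
boundary of the zonotope and does not contribute at `x`. -/
theorem IsFineZonotopalTiling.sum_signs_eq_zero (hP : IsFineZonotopalTiling a P)
    {J C : Finset (Fin n)} {x : Fin d → ℝ} (hx : x ∈ hull a Jᶜ) (hxJC : x ∈ hull a (J ∪ C))
    (hxC : facetForm a C (lift x) ≠ 0) :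
    ∑ p ∈ incidences P J C, facetForm a C (inward a J p.2) / |facetForm a C (inward a J p.2)| =
      0 := by
  refine sum_eq_zero_of_signs (fun p hp => ?_) (fun p hp p' hp' h => ?_) fun p hp => ?_
  · obtain ⟨h1, h2⟩ := mem_incidences.1 hp
    exact div_abs_eq_one_or (h2.facetForm_ne_zero (hP.basis _ h1))
  · obtain ⟨h1, h2⟩ := mem_incidences.1 hp
    obtain ⟨h1', h2'⟩ := mem_incidences.1 hp'
    obtain ⟨e1, e2⟩ := hP.incident_unique h1 h1' h2 h2'
      (mul_pos_of_div_abs_eq (h2.facetForm_ne_zero (hP.basis _ h1))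
        (h2'.facetForm_ne_zero (hP.basis _ h1')) h)
    exact Prod.ext e1 e2
  · obtain ⟨h1, h2⟩ := mem_incidences.1 hp
    set σ := facetForm a C (inward a J p.2) with hσ
    have hσ0 : σ ≠ 0 := h2.facetForm_ne_zero (hP.basis _ h1)
    suffices h : ∃ T' ∈ P, ∃ b', IsIncident J C T' b' ∧
        facetForm a C (inward a J b') * σ < 0 by
      obtain ⟨T', hT', b', hinc, hneg⟩ := h
      exact ⟨(T', b'), mem_incidences.2 ⟨hT', hinc⟩, div_abs_eq_neg_of_mul_neg hneg⟩
    -- With no tile across the facet, every direction w that stays in the zonotope satisfies σ ·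
    -- `facetForm a C w` ≥ 0. The directions v_i with i ∉ J and −v_i with i ∈ J (i ∉ C) then give
    -- both signs at x, so the form vanishes there.
    by_contra! hcon
    have hJC := h2.disjoint (hP.disjoint _ h1)
    have hnonneg : ∀ w : Fin (d + 1) → ℝ,
        (∀ᶠ t in 𝓝[>] (0 : ℝ), barycentre a J C + t • w ∈ zonotope a) →
        0 ≤ σ * facetForm a C w := by
      intro w hZ
      by_contra! hneg
      obtain ⟨T', hT', b', hinc, hpos⟩ := hP.exists_incident h1 h2 hneg hZ
      have h3 := hcon T' hT' b' hinc
      have h4 := mul_neg_of_pos_of_neg hpos hneg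
      have h5 : facetForm a C (inward a J b') * facetForm a C w * (σ * facetForm a C w) =
        facetForm a C (inward a J b') * σ * (facetForm a C w * facetForm a C w) := by ring
      rw [h5] at h4
      exact absurd (mul_nonneg h3 (mul_self_nonneg (facetForm a C w))) (not_le.2 h4)
    have hout : 0 ≤ (σ • facetForm a C) (lift x) := by
      refine map_lift_nonneg_of_mem_hull hx _ fun i hi => ?_
      rw [LinearMap.smul_apply, smul_eq_mul]
      by_cases hiC : i ∈ C
      · rw [facetForm_lift_of_mem hiC, mul_zero]
      · refine hnonneg _ ?_
        have := eventually_barycentre_add_mem_zonotope (a := a) hJC hiC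
          (Or.inr ⟨Finset.mem_compl.1 hi, rfl⟩)
        simpa only [one_smul] using this
    have hin : 0 ≤ (-(σ • facetForm a C)) (lift x) := by
      refine map_lift_nonneg_of_mem_hull hxJC _ fun i hi => ?_
      rw [LinearMap.neg_apply, LinearMap.smul_apply, smul_eq_mul]
      by_cases hiC : i ∈ C
      · rw [facetForm_lift_of_mem hiC, mul_zero, neg_zero]
      · have hiJ : i ∈ J := by
          rcases Finset.mem_union.1 hi with h | h
          · exact h
          · exact absurd h hiC
        have := hnonneg _ (eventually_barycentre_add_mem_zonotope (a := a) hJC hiC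
          (Or.inl ⟨hiJ, rfl⟩))
        rwa [map_smul, neg_smul, one_smul, mul_neg] at this
    rw [LinearMap.neg_apply] at hin
    have h0 : (σ • facetForm a C) (lift x) = 0 := by linarith
    rw [LinearMap.smul_apply, smul_eq_mul] at h0
    exact (mul_ne_zero hσ0 hxC) h0

/-- The tiles with `I = ∅` form a triangulation. -/
theorem IsFineZonotopalTiling.sum_closedInd (hP : IsFineZonotopalTiling a P) (hn : d ≤ n)
    {y : Fin d → ℝ} (hy : y ∈ hull a Finset.univ) (hgen : IsGeneric a y) :
    ∑ T ∈ P with T.1.card = 0, closedInd a T.2 y = 1 := by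
  have hmem : ∀ T ∈ P, T.1 = ∅ → y ∈ hull a T.2 → (1 / 2 : ℝ) • lift y ∈ tile a T := by
    intro T _ hT1 hyT
    obtain ⟨w, hw, hw0, hwy⟩ := mem_hull_iff.1 hyT
    refine ⟨fun i => 1 / 2 * (if i ∈ T.2 then w i else 0), fun i => ?_, ?_⟩
    · beta_reduce
      split_ifs with hi
      · have h1 := (sum_smul_lift_eq_lift.1 hwy).1
        have h2 := Finset.single_le_sum (fun i _ => hw i) hi
        rw [h1] at h2
        have := hw i
        constructor <;> linarith
      · norm_num
    · rw [hT1, Finset.sum_empty, zero_add, ← hwy, Finset.smul_sum]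
      exact Finset.sum_congr rfl fun i hi => by
        beta_reduce
        rw [if_pos hi, smul_smul]
  -- The last coordinate of a point of `tile a F` is at least `F.1.card`. Scaling y to height 1/2
  -- thus forces `F.1 = ∅`, and also keeps all coefficients at most 1.
  have hlow : ∀ F : Finset (Fin n) × Finset (Fin n), (1 / 2 : ℝ) • lift y ∈ tile a F →
      F.1 = ∅ ∧ y ∈ hull a F.2 := by
    rintro F ⟨α, hα, h⟩
    have hF1 : F.1 = ∅ := by
      have := congrFun h (Fin.last d)
      simp only [Pi.smul_apply, Pi.add_apply, Finset.sum_apply, lift_last, smul_eq_mul, mul_one,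
        Finset.sum_const, nsmul_eq_mul] at this
      have h2 : 0 ≤ ∑ i ∈ F.2, α i := Finset.sum_nonneg fun i _ => (hα i).1
      have h3 : (F.1.card : ℝ) < 1 := by linarith
      exact Finset.card_eq_zero.1 (by exact_mod_cast Nat.lt_one_iff.1 (by exact_mod_cast h3))
    refine ⟨hF1, mem_hull_iff.2 ⟨fun i => if i ∈ F.2 then 2 * α i else 0, fun i => ?_,
      fun i hi => if_neg hi, ?_⟩⟩
    · have := (hα i).1
      beta_reduce
      split_ifs <;> linarith
    · rw [hF1, Finset.sum_empty, zero_add] at h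
      have e : ∑ i ∈ F.2, (if i ∈ F.2 then 2 * α i else 0) • lift (a i) =
          ∑ i ∈ F.2, (2 : ℝ) • α i • lift (a i) :=
        Finset.sum_congr rfl fun i hi => by rw [if_pos hi, mul_smul]
      rw [e, ← Finset.smul_sum, ← h, smul_smul]
      norm_num
  have hex : ∃ T ∈ P, T.1 = ∅ ∧ y ∈ hull a T.2 := by
    have hZ : (1 / 2 : ℝ) • lift y ∈ zonotope a := by
      obtain ⟨w, hw, -, hwy⟩ := mem_hull_iff.1 hy
      refine ⟨fun i => 1 / 2 * w i, fun i => ?_, ?_⟩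
      · have h1 := (sum_smul_lift_eq_lift.1 hwy).1
        have h2 := Finset.single_le_sum (fun i _ => hw i) (Finset.mem_univ i)
        rw [h1] at h2
        have := hw i
        constructor <;> linarith
      · simp only [mul_smul]
        rw [← Finset.smul_sum, hwy]
    rw [← hP.cover, Set.mem_iUnion₂] at hZ
    obtain ⟨T, hT, hz⟩ := hZ
    exact ⟨T, hT, hlow T hz⟩
  obtain ⟨T, hT, hT1, hyT⟩ := hex
  rw [Finset.sum_eq_single_of_mem T (Finset.mem_filter.2 ⟨hT, by rw [hT1]; rfl⟩)]
  · rw [closedInd, Set.indicator_of_mem hyT]; rfl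
  · intro T' hT' hne
    obtain ⟨hT'P, hT'1⟩ := Finset.mem_filter.1 hT'
    refine Set.indicator_of_notMem (fun hyT' => ?_) _
    obtain ⟨F, hF, hF', hzF⟩ := hP.exists_face hT hT'P (hmem T hT hT1 hyT)
      (hmem T' hT'P (Finset.card_eq_zero.1 hT'1) hyT')
    have hlt : F.2.card < d + 1 := by
      rw [← (hP.basis T hT).1]
      refine Finset.card_lt_card (hF.1.ssubset_of_ne fun e => hne ?_)
      exact (hF.eq_of_snd_eq hF' (hP.basis T hT) (hP.basis T' hT'P) e).symm
    -- Genericity concerns sets of exactly d indices, so the possibly smaller `F.2` is enlarged;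
    -- this uses d ≤ n.
    obtain ⟨S, hS, hScard⟩ := Finset.exists_superset_card_eq (s := F.2) (n := d) (by omega)
      (by simpa using hn)
    exact hgen S hScard (hull_mono hS (hlow F hzF).2)

end Balance

/-- `Q` is symmetric and affine in each of its arguments. -/
structure IsSymmMultiaffine {d k : ℕ} (Q : (Fin k → Fin d → ℝ) → ℝ) : Prop where
  symm : ∀ (π : Equiv.Perm (Fin k)) (y : Fin k → Fin d → ℝ), Q (y ∘ π) = Q y
  affine : ∀ (y : Fin k → Fin d → ℝ) (j : Fin k),
    ∃ f : (Fin d → ℝ) →ᵃ[ℝ] ℝ, ∀ z, Q (Function.update y j z) = f z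

/-! ### Symmetric multiaffine functions -/

namespace IsSymmMultiaffine

variable {k : ℕ} {Q : (Fin (k + 1) → Fin d → ℝ) → ℝ}

theorem cons (hQ : IsSymmMultiaffine Q) (x : Fin d → ℝ) :
    IsSymmMultiaffine fun y : Fin k → Fin d → ℝ => Q (Fin.cons x y) where
  symm π y := by
    rw [← hQ.symm (Equiv.Perm.decomposeFin.symm (0, π)) (Fin.cons x y)]
    congr 1
    funext i
    refine Fin.cases ?_ (fun j => ?_) i
    · simp
    · simp
  affine y j := by
    obtain ⟨f, hf⟩ := hQ.affine (Fin.cons x y) j.succ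
    exact ⟨f, fun z => by rw [← hf, Fin.cons_update]⟩

/-- `polarAt` lists its arguments in increasing order of the index; symmetry allows the new point to
be put first. -/
theorem polarAt_insert (hQ : IsSymmMultiaffine Q) (a : Fin n → Fin d → ℝ) {I : Finset (Fin n)}
    {b : Fin n} (hI : I.card = k) (hb : b ∉ I) :
    polarAt a Q (insert b I) = polarAt a (fun y => Q (Fin.cons (a b) y)) I := by
  have h' : (insert b I).card = k + 1 := by rw [Finset.card_insert_of_notMem hb, hI]
  have hinj : Function.Injective (Fin.cons b (I.orderEmbOfFin hI) : Fin (k + 1) → Fin n) := by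
    rw [Fin.cons_injective_iff]
    refine ⟨?_, (I.orderEmbOfFin hI).injective⟩
    rw [Finset.range_orderEmbOfFin]; exact hb
  obtain ⟨σ, hσ⟩ := exists_perm_of_range_subset (g := (insert b I).orderEmbOfFin h') hinj (by
    intro i
    have : (Fin.cons b (I.orderEmbOfFin hI) : Fin (k + 1) → Fin n) i ∈
        Set.range ((insert b I).orderEmbOfFin h') := by
      rw [Finset.range_orderEmbOfFin]
      refine Fin.cases ?_ (fun j => ?_) i
      · simp
      · simp
    exact this)
  rw [polarAt, dif_pos h', polarAt, dif_pos hI, ← hQ.symm σ]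
  congr 1
  funext i
  have := congrFun hσ i
  simp only [Function.comp_apply] at this ⊢
  rw [← this]
  refine Fin.cases ?_ (fun j => ?_) i
  · simp
  · simp

theorem sum_cons (hQ : IsSymmMultiaffine Q) {a : Fin n → Fin d → ℝ} {B : Finset (Fin n)}
    {w : Fin n → ℝ} {x : Fin d → ℝ} (hw : ∑ b ∈ B, w b • lift (a b) = lift x)
    (y : Fin k → Fin d → ℝ) : ∑ b ∈ B, w b * Q (Fin.cons (a b) y) = Q (Fin.cons x y) := by
  obtain ⟨f, hf⟩ := hQ.affine (Fin.cons 0 y) 0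
  simp only [Fin.update_cons_zero] at hf
  obtain ⟨h1, h2⟩ := sum_smul_lift_eq_lift.1 hw
  simp only [hf]
  have e : ∀ z, f z = f.linear z + f 0 := fun z => by
    have := f.map_vadd 0 z
    simpa using this
  have e' : ∀ b ∈ B, w b * f (a b) = w b * f.linear (a b) + w b * f 0 := fun b _ => by
    rw [e (a b), mul_add]
  rw [Finset.sum_congr rfl e', Finset.sum_add_distrib, ← Finset.sum_mul, h1, one_mul, e x, ← h2,
    map_sum]
  simp only [map_smul, smul_eq_mul]

theorem sum_polarAt_insert (hQ : IsSymmMultiaffine Q) {a : Fin n → Fin d → ℝ}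
    {I B : Finset (Fin n)} {w : Fin n → ℝ} {x : Fin d → ℝ} (hI : I.card = k)
    (hIB : Disjoint I B) (hw : ∑ b ∈ B, w b • lift (a b) = lift x) :
    ∑ b ∈ B, w b * polarAt a Q (insert b I) = polarAt a (fun y => Q (Fin.cons x y)) I := by
  have : ∀ b ∈ B, w b * polarAt a Q (insert b I) =
      w b * Q (Fin.cons (a b) fun j => a (I.orderEmbOfFin hI j)) := fun b hb => by
    rw [hQ.polarAt_insert a hI (Finset.disjoint_right.1 hIB hb), polarAt, dif_pos hI]
  rw [Finset.sum_congr rfl this, hQ.sum_cons hw, polarAt, dif_pos hI]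

end IsSymmMultiaffine

/-! ### The induction on the degree -/

section Reproduction

variable {a : Fin n → Fin d → ℝ} {P : Finset (Finset (Fin n) × Finset (Fin n))}

theorem mem_hull_compl_of_mem_chk {k : ℕ} {x : Fin d → ℝ} (hx : x ∈ chk a k) {J : Finset (Fin n)}
    (hJ : J.card = k) : x ∈ hull a Jᶜ := by
  refine hx _ ?_
  have := Finset.card_add_card_compl J
  rw [Fintype.card_fin] at this
  omega

theorem chk_succ_subset {k : ℕ} (hk : k + 1 ≤ n) : chk a (k + 1) ⊆ chk a k := by
  intro x hx S hS
  have hne : S.Nonempty := by rw [← Finset.card_pos]; omega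
  obtain ⟨i, hi⟩ := hne
  refine hull_mono (Finset.erase_subset i S) (hx _ ?_)
  rw [Finset.card_erase_of_mem hi]
  have : 0 < S.card := Finset.card_pos.2 ⟨i, hi⟩
  omega

/-- This isolates the dependence on `b` in a sign: the other factor belongs to the facet `B.erase b`
and is shared by the tiles on both sides. -/
theorem posDet_mul_detQuot {B : Finset (Fin n)} {b : Fin n} (hb : b ∈ B) (x : Fin d → ℝ) :
    posDet a B * detQuot a B b x = facetForm a (B.erase b) (lift x) *
      (facetForm a (B.erase b) (lift (a b)) / |facetForm a (B.erase b) (lift (a b))|) := by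
  rw [posDet_eq_of_mem hb, detQuot_eq hb]
  rcases abs_choice (facetForm a (B.erase b) (lift (a b))) with h | h <;> rw [h]
  · ring
  · rw [div_neg]; ring

/-- Resummation over facets: each facet is counted once as a lower and once as an upper facet of
the tiles incident to it. -/
theorem sum_incidences (hd : ∀ T ∈ P, Disjoint T.1 T.2) (k : ℕ)
    (h : Finset (Fin n) → Finset (Fin n) → Fin n → ℝ) :
    ∑ q : Finset (Fin n) × Finset (Fin n) with q.1.card = k + 1,
        ∑ p ∈ incidences P q.1 q.2, h q.1 q.2 p.2 =
      ∑ T ∈ P with T.1.card = k + 1, ∑ b ∈ T.2, h T.1 (T.2.erase b) b +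
      ∑ T ∈ P with T.1.card = k, ∑ b ∈ T.2, h (insert b T.1) (T.2.erase b) b := by
  classical
  rw [Finset.sum_comm' (s' := fun p => ({(p.1.1, p.1.2.erase p.2),
    (insert p.2 p.1.1, p.1.2.erase p.2)} : Finset (Finset (Fin n) × Finset (Fin n))).filter
      fun q => q.1.card = k + 1)
    (t' := (P ×ˢ Finset.univ).filter fun p => p.2 ∈ p.1.2)]
  · have hinner : ∀ p ∈ (P ×ˢ (Finset.univ : Finset (Fin n))).filter fun p => p.2 ∈ p.1.2,
        ∑ q ∈ ({(p.1.1, p.1.2.erase p.2), (insert p.2 p.1.1, p.1.2.erase p.2)} :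
          Finset (Finset (Fin n) × Finset (Fin n))).filter fun q => q.1.card = k + 1,
            h q.1 q.2 p.2 =
          (if p.1.1.card = k + 1 then h p.1.1 (p.1.2.erase p.2) p.2 else 0) +
          (if p.1.1.card = k then h (insert p.2 p.1.1) (p.1.2.erase p.2) p.2 else 0) := by
      rintro ⟨T, b⟩ hp
      obtain ⟨hp1, hb⟩ := Finset.mem_filter.1 hp
      have hbT : b ∉ T.1 :=
        Finset.disjoint_right.1 (hd T (Finset.mem_product.1 hp1).1) hb
      have hne : (T.1, T.2.erase b) ≠ (insert b T.1, T.2.erase b) := by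
        intro h
        exact hbT (by rw [(Prod.ext_iff.1 h).1]; exact Finset.mem_insert_self _ _)
      rw [Finset.sum_filter, Finset.sum_pair hne]
      simp [Finset.card_insert_of_notMem hbT]
    rw [Finset.sum_congr rfl hinner, Finset.sum_filter, Finset.sum_product, Finset.sum_filter,
      Finset.sum_filter, ← Finset.sum_add_distrib]
    refine Finset.sum_congr rfl fun T _ => ?_
    dsimp only
    rw [Finset.sum_ite_mem, Finset.univ_inter, Finset.sum_add_distrib]
    congr 1
    · split_ifs <;> simp
    · split_ifs <;> simp
  · rintro ⟨J, C⟩ ⟨T, b⟩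
    simp only [Finset.mem_filter, Finset.mem_univ, true_and, mem_incidences, IsIncident,
      Finset.mem_insert, Finset.mem_singleton, Finset.mem_product, Prod.mk.injEq, and_true]
    constructor
    · rintro ⟨h1, h2, h3, h4, h5 | h5⟩
      · exact ⟨⟨Or.inl ⟨h5.symm, h4.symm⟩, h1⟩, h2, h3⟩
      · exact ⟨⟨Or.inr ⟨h5.symm, h4.symm⟩, h1⟩, h2, h3⟩
    · rintro ⟨⟨⟨h5, h4⟩ | ⟨h5, h4⟩, h1⟩, h2, h3⟩
      · exact ⟨h1, h2, h3, h4.symm, Or.inl h5.symm⟩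
      · exact ⟨h1, h2, h3, h4.symm, Or.inr h5.symm⟩

/-- Both sides are facet sums at level |J| = k+1, over lower and upper facets respectively. The
inward vector is v_b for a lower facet and −v_b for an upper one, so the vanishing total says that
the two sides agree. -/
theorem IsFineZonotopalTiling.sum_polarAt_succ (hP : IsFineZonotopalTiling a P) {k : ℕ}
    {x : Fin d → ℝ} (hx : x ∈ chk a (k + 1)) {M : Finset (Fin n) → ℝ}
    (hM : ∀ X, M X ≠ 0 → x ∈ hull a X) (R : Finset (Fin n) → ℝ) :
    ∑ T ∈ P with T.1.card = k + 1, R T.1 * posDet a T.2 *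
        ∑ b ∈ T.2, detQuot a T.2 b x * M ((T.1 ∪ T.2).erase b) =
      ∑ T ∈ P with T.1.card = k, posDet a T.2 * M (T.1 ∪ T.2) *
        ∑ b ∈ T.2, detQuot a T.2 b x * R (insert b T.1) := by
  have hz := sum_incidences hP.disjoint k fun J C b => R J * facetForm a C (lift x) * M (J ∪ C) *
    (facetForm a C (inward a J b) / |facetForm a C (inward a J b)|)
  rw [Finset.sum_eq_zero] at hz
  · have h1 : ∑ T ∈ P with T.1.card = k + 1, R T.1 * posDet a T.2 *
        ∑ b ∈ T.2, detQuot a T.2 b x * M ((T.1 ∪ T.2).erase b) =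
        ∑ T ∈ P with T.1.card = k + 1, ∑ b ∈ T.2,
          R T.1 * facetForm a (T.2.erase b) (lift x) * M (T.1 ∪ T.2.erase b) *
          (facetForm a (T.2.erase b) (inward a T.1 b) /
            |facetForm a (T.2.erase b) (inward a T.1 b)|) := by
      refine Finset.sum_congr rfl fun T hT => ?_
      rw [Finset.mul_sum]
      refine Finset.sum_congr rfl fun b hb => ?_
      have hbT : b ∉ T.1 :=
        Finset.disjoint_right.1 (hP.disjoint T (Finset.mem_filter.1 hT).1) hb
      rw [inward, if_neg hbT, Finset.erase_union_distrib, Finset.erase_eq_of_notMem hbT,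
        mul_assoc (R T.1), ← mul_assoc (posDet a T.2), posDet_mul_detQuot hb]
      ring
    have h2 : ∑ T ∈ P with T.1.card = k, posDet a T.2 * M (T.1 ∪ T.2) *
        ∑ b ∈ T.2, detQuot a T.2 b x * R (insert b T.1) =
        -∑ T ∈ P with T.1.card = k, ∑ b ∈ T.2,
          R (insert b T.1) * facetForm a (T.2.erase b) (lift x) *
            M (insert b T.1 ∪ T.2.erase b) *
          (facetForm a (T.2.erase b) (inward a (insert b T.1) b) /
            |facetForm a (T.2.erase b) (inward a (insert b T.1) b)|) := by
      rw [← Finset.sum_neg_distrib]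
      refine Finset.sum_congr rfl fun T hT => ?_
      rw [Finset.mul_sum, ← Finset.sum_neg_distrib]
      refine Finset.sum_congr rfl fun b hb => ?_
      have hu : insert b T.1 ∪ T.2.erase b = T.1 ∪ T.2 := by
        rw [Finset.insert_union, ← Finset.union_insert, Finset.insert_erase hb]
      rw [inward, if_pos (Finset.mem_insert_self _ _), hu, map_neg, abs_neg, neg_div,
        mul_mul_mul_comm, posDet_mul_detQuot hb]
      ring
    rw [h1, h2]
    linarith
  -- A facet contributes nothing if the spline vanishes or x lies on its hyperplane; otherwise the
  -- signs cancel.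
  · rintro ⟨J, C⟩ hq
    have hJ : J.card = k + 1 := (Finset.mem_filter.1 hq).2
    rw [← Finset.mul_sum]
    by_cases h1 : M (J ∪ C) = 0
    · simp [h1]
    by_cases h2 : facetForm a C (lift x) = 0
    · simp [h2]
    rw [hP.sum_signs_eq_zero (mem_hull_compl_of_mem_chk hx hJ) (hM _ h1) h2, mul_zero]

theorem IsFineZonotopalTiling.sum_polarAt_spline (hP : IsFineZonotopalTiling a P)
    {χ : Finset (Fin n) → (Fin d → ℝ) → ℝ} {sel : Finset (Fin n) → Finset (Fin n)}
    (hsel : IsSelection a sel) {x : Fin d → ℝ} (hR : RespectsRelations a χ sel x 0)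
    (hχ : ∀ B, IsBasis a B → χ B x ≠ 0 → x ∈ hull a B)
    (hsum : ∑ T ∈ P with T.1.card = 0, χ T.2 x = 1) {k : ℕ} (hk : k ≤ n) (hx : x ∈ chk a k)
    {Q : (Fin k → Fin d → ℝ) → ℝ} (hQ : IsSymmMultiaffine Q) :
    ∑ T ∈ P with T.1.card = k,
        polarAt a Q T.1 * posDet a T.2 * spline a χ sel k (T.1 ∪ T.2) x =
      ((k + d).factorial : ℝ) / (k.factorial : ℝ) * Q fun _ => x := by
  induction k with
  | zero =>
    have : ∀ T ∈ P.filter fun T => T.1.card = 0,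
        polarAt a Q T.1 * posDet a T.2 * spline a χ sel 0 (T.1 ∪ T.2) x =
          d.factorial * (Q fun _ => x) * χ T.2 x := by
      intro T hT
      obtain ⟨hTP, hT0⟩ := Finset.mem_filter.1 hT
      have hB := hP.basis T hTP
      have hpos := hB.posDet_pos.ne'
      rw [Finset.card_eq_zero.1 hT0, Finset.empty_union, spline, if_pos hB, polarAt,
        dif_pos Finset.card_empty, Subsingleton.elim (fun j => a _) fun _ => x]
      field_simp
    rw [Finset.sum_congr rfl this, ← Finset.mul_sum, hsum]
    simp
  | succ k ih =>
    -- The recursion is expanded in the tile's own basis `T.2`, with weights extended by zero to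
    -- `T.1`, whatever `sel` chooses.
    have hstep : ∀ T ∈ P.filter fun T => T.1.card = k + 1,
        polarAt a Q T.1 * posDet a T.2 * spline a χ sel (k + 1) (T.1 ∪ T.2) x =
          ((k + 1 + d : ℕ) : ℝ) / ((k + 1 : ℕ) : ℝ) * (polarAt a Q T.1 * posDet a T.2 *
            ∑ b ∈ T.2, detQuot a T.2 b x * spline a χ sel k ((T.1 ∪ T.2).erase b) x) := by
      intro T hT
      have hB := hP.basis T (Finset.mem_filter.1 hT).1
      have hsub : T.2 ⊆ T.1 ∪ T.2 := Finset.subset_union_right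
      rw [(RespectsRelations.of_zero hsel hR k).spline_succ hsel (X := T.1 ∪ T.2)
        (ν := fun b => if b ∈ T.2 then detQuot a T.2 b x else 0), mul_left_comm,
        ← Finset.sum_subset hsub]
      · congr 2
        exact Finset.sum_congr rfl fun b hb => by rw [if_pos hb]
      · intro b _ hb; simp [hb]
      · rw [← hB.sum_detQuot x, ← Finset.sum_subset hsub]
        · exact Finset.sum_congr rfl fun b hb => by rw [if_pos hb]
        · intro b _ hb; simp [hb]
    rw [Finset.sum_congr rfl hstep, ← Finset.mul_sum,
      hP.sum_polarAt_succ hx (M := fun X => spline a χ sel k X x)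
        (fun X => mem_hull_of_spline_ne_zero hχ k X) (polarAt a Q)]
    have hred : ∀ T ∈ P.filter fun T => T.1.card = k,
        posDet a T.2 * spline a χ sel k (T.1 ∪ T.2) x *
          ∑ b ∈ T.2, detQuot a T.2 b x * polarAt a Q (insert b T.1) =
        polarAt a (fun y => Q (Fin.cons x y)) T.1 * posDet a T.2 *
          spline a χ sel k (T.1 ∪ T.2) x := by
      intro T hT
      obtain ⟨hTP, hTk⟩ := Finset.mem_filter.1 hT
      rw [hQ.sum_polarAt_insert hTk (hP.disjoint T hTP) ((hP.basis T hTP).sum_detQuot x)]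
      ring
    -- The induction hypothesis is applied to Q(x, ·), so it must hold for all symmetric multiaffine
    -- functions; it applies at x since ch_{k+1}(A) ⊆ ch_k(A).
    rw [Finset.sum_congr rfl hred, ih (by omega) (chk_succ_subset hk hx) (hQ.cons x)]
    have hcons : (Fin.cons x fun _ => x : Fin (k + 1) → Fin d → ℝ) = fun _ => x := by
      funext i
      refine Fin.cases ?_ (fun j => ?_) i <;> simp
    rw [hcons, Nat.factorial_succ k, show k + 1 + d = (k + d) + 1 by ring, Nat.factorial_succ]
    push_cast
    have : (k.factorial : ℝ) ≠ 0 := by exact_mod_cast k.factorial_ne_zero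
    field_simp

end Reproduction

/-- The tile is a translate of the image of the unit cube under the transposed matrix of lifted
points. -/
theorem volume_tile {a : Fin n → Fin d → ℝ} {T : Finset (Fin n) × Finset (Fin n)}
    (h : T.2.card = d + 1) : volume.real (tile a T) = posDet a T.2 := by
  set A : Matrix (Fin (d + 1)) (Fin (d + 1)) ℝ :=
    Matrix.of fun i : Fin (d + 1) => lift (a (T.2.orderEmbOfFin h i)) with hA
  have hsum : ∀ α : Fin n → ℝ, ∑ b ∈ T.2, α b • lift (a b) =
      Matrix.toLin' A.transpose (fun j => α (T.2.orderEmbOfFin h j)) := by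
    intro α
    conv_lhs => rw [← Finset.map_orderEmbOfFin_univ T.2 h, Finset.sum_map]
    rw [Matrix.toLin'_apply, Matrix.mulVec_transpose]
    funext i
    simp [Matrix.vecMul, dotProduct, hA]
  have htile : tile a T = (fun z => (∑ i ∈ T.1, lift (a i)) + z) ''
      (Matrix.toLin' A.transpose '' Set.Icc 0 1) := by
    ext z
    constructor
    · rintro ⟨α, hα, rfl⟩
      refine ⟨_, ⟨fun j => α (T.2.orderEmbOfFin h j), ⟨fun j => (hα _).1, fun j => (hα _).2⟩, rfl⟩,
        ?_⟩
      rw [hsum]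
    · rintro ⟨_, ⟨β, hβ, rfl⟩, rfl⟩
      let α : Fin n → ℝ := Function.extend (T.2.orderEmbOfFin h) β 0
      have hαβ : (fun j => α (T.2.orderEmbOfFin h j)) = β := by
        funext j
        exact (T.2.orderEmbOfFin h).injective.extend_apply _ _ _
      refine ⟨α, fun i => ?_, by rw [hsum, hαβ]⟩
      by_cases hi : ∃ j, T.2.orderEmbOfFin h j = i
      · obtain ⟨j, rfl⟩ := hi
        rw [show α (T.2.orderEmbOfFin h j) = β j from congrFun hαβ j]
        exact ⟨hβ.1 j, hβ.2 j⟩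
      · simp only [α, Function.extend_apply' _ _ _ hi]
        simp
  rw [htile, Measure.real, Set.image_add_left, measure_preimage_add,
    Measure.addHaar_image_linearMap, LinearMap.det_toLin', Matrix.det_transpose, Real.volume_Icc_pi]
  simp [posDet, orderedDet, h, hA]

/-! ### Existence of polar forms -/

section Polarization

/-- Averaging over permutations gives symmetry; in each summand the argument `y i` occurs only in
the factor `π.symm i`, so the sum is affine in it. -/
theorem isPolarForm_symmetrization {k : ℕ} (g : Fin k → (Fin d → ℝ) →ᵃ[ℝ] ℝ)
    (q : MvPolynomial (Fin d) ℝ) (hq : ∀ x, ∏ j, g j x = MvPolynomial.eval x q) :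
    IsPolarForm k q fun y =>
      (k.factorial : ℝ)⁻¹ * ∑ π : Equiv.Perm (Fin k), ∏ j, g j (y (π j)) where
  symm π y := by
    congr 1
    exact Fintype.sum_equiv (Equiv.mulLeft π) _ _ fun σ => rfl
  affine y i := by
    refine ⟨(k.factorial : ℝ)⁻¹ • ∑ π : Equiv.Perm (Fin k),
      (∏ j ∈ Finset.univ.erase (π.symm i), g j (y (π j))) • g (π.symm i), fun z => ?_⟩
    have hsum : ∀ (s : Finset (Equiv.Perm (Fin k)))
        (f : Equiv.Perm (Fin k) → (Fin d → ℝ) →ᵃ[ℝ] ℝ), (∑ π ∈ s, f π) z = ∑ π ∈ s, f π z := by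
      intro s f
      classical
      induction s using Finset.induction_on with
      | empty => simp
      | insert π s hπ ih => rw [Finset.sum_insert hπ, Finset.sum_insert hπ, ← ih]; rfl
    rw [AffineMap.coe_smul, Pi.smul_apply, hsum, smul_eq_mul]
    congr 1
    refine Finset.sum_congr rfl fun π _ => ?_
    rw [← Finset.prod_erase_mul _ _ (Finset.mem_univ (π.symm i)), AffineMap.coe_smul,
      Pi.smul_apply, smul_eq_mul]
    congr 1
    · refine Finset.prod_congr rfl fun j hj => ?_
      rw [Function.update_of_ne]
      rintro rfl
      exact Finset.ne_of_mem_erase hj (by simp)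
    · simp
  diag x := by
    simp only [hq, Finset.sum_const, Finset.card_univ, Fintype.card_perm, Fintype.card_fin,
      nsmul_eq_mul]
    rw [inv_mul_cancel_left₀ (by exact_mod_cast k.factorial_ne_zero)]

/-- A monomial of degree below k is padded with constant factors 1. -/
theorem exists_affine_prod_eq (k : ℕ) (l : List (Fin d)) (hl : l.length ≤ k) :
    ∃ g : Fin k → (Fin d → ℝ) →ᵃ[ℝ] ℝ, ∀ x : Fin d → ℝ, ∏ j, g j x = (l.map x).prod := by
  induction k generalizing l with
  | zero =>
    have : l = [] := List.length_eq_zero_iff.1 (by omega)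
    exact ⟨fun j => j.elim0, fun x => by simp [this]⟩
  | succ k ih =>
    cases l with
    | nil => exact ⟨fun _ => AffineMap.const ℝ _ 1, fun x => by simp⟩
    | cons i l =>
      obtain ⟨g, hg⟩ := ih l (by simpa using hl)
      refine ⟨Fin.cons (LinearMap.proj i : (Fin d → ℝ) →ₗ[ℝ] ℝ).toAffineMap g, fun x => ?_⟩
      rw [Fin.prod_univ_succ]
      simp [hg]

theorem exists_isPolarForm_monomial {k : ℕ} (m : Fin d →₀ ℕ) (hm : (m.sum fun _ e => e) ≤ k) :
    ∃ Q, IsPolarForm k (MvPolynomial.monomial m (1 : ℝ)) Q := by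
  classical
  obtain ⟨g, hg⟩ := exists_affine_prod_eq k (Finsupp.toMultiset m).toList
    (by rw [Multiset.length_toList, Finsupp.card_toMultiset]; exact hm)
  refine ⟨_, isPolarForm_symmetrization g _ fun x => ?_⟩
  rw [hg, MvPolynomial.eval_monomial, one_mul, ← Multiset.prod_coe, ← Multiset.map_coe,
    Multiset.coe_toList, Finset.prod_multiset_map_count, Finsupp.toFinset_toMultiset]
  simp [Finsupp.prod, Finsupp.count_toMultiset]

theorem exists_isPolarForm {k : ℕ} (q : MvPolynomial (Fin d) ℝ) (hq : q.totalDegree ≤ k) :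
    ∃ Q, IsPolarForm k q Q := by
  have h : ∀ m ∈ q.support, ∃ Q, IsPolarForm k (MvPolynomial.monomial m (1 : ℝ)) Q :=
    fun m hm => exists_isPolarForm_monomial m ((MvPolynomial.le_totalDegree hm).trans hq)
  choose! Q hQ using h
  refine ⟨fun y => ∑ m ∈ q.support, q.coeff m * Q m y, fun π y => ?_, fun y j => ?_, fun x => ?_⟩
  · exact Finset.sum_congr rfl fun m hm => by rw [(hQ m hm).symm]
  · have h : ∀ m ∈ q.support, ∃ f : (Fin d → ℝ) →ᵃ[ℝ] ℝ,
        ∀ z, Q m (Function.update y j z) = f z := fun m hm => (hQ m hm).affine y j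
    choose! f hf using h
    refine ⟨∑ m ∈ q.support, q.coeff m • f m, fun z => ?_⟩
    have hsum : ∀ (s : Finset (Fin d →₀ ℕ)) (f : (Fin d →₀ ℕ) → (Fin d → ℝ) →ᵃ[ℝ] ℝ),
        (∑ m ∈ s, f m) z = ∑ m ∈ s, f m z := by
      intro s f
      classical
      induction s using Finset.induction_on with
      | empty => simp
      | insert m s hm ih => rw [Finset.sum_insert hm, Finset.sum_insert hm, ← ih]; rfl
    rw [hsum]
    exact Finset.sum_congr rfl fun m hm => by rw [hf m hm]; rfl
  · rw [MvPolynomial.eval_eq]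
    refine Finset.sum_congr rfl fun m hm => ?_
    rw [(hQ m hm).diag, MvPolynomial.eval_monomial, one_mul]
    rfl

end Polarization

/-- Both versions of the identity are instances. Coordinates, polar form and ch_k(A) refer to x,
while the indicators are read off at the generic point y. -/
theorem IsFineZonotopalTiling.eval_eq_splineSum {a : Fin n → Fin d → ℝ}
    {P : Finset (Finset (Fin n) × Finset (Fin n))} (hP : IsFineZonotopalTiling a P)
    {χ : Finset (Fin n) → (Fin d → ℝ) → ℝ} {sel : Finset (Fin n) → Finset (Fin n)}
    (hsel : IsSelection a sel) {x : Fin d → ℝ}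
    (hχ : ∀ B, IsBasis a B → χ B x ≠ 0 → x ∈ hull a B)
    {y : Fin d → ℝ} (hy : y ∈ hull a Finset.univ) (hgen : IsGeneric a y)
    (hχy : ∀ B, χ B x = closedInd a B y) {k : ℕ} (hk : k + d + 1 ≤ n) (hx : x ∈ chk a k)
    {q : MvPolynomial (Fin d) ℝ} {Q : (Fin k → Fin d → ℝ) → ℝ} (hQ : IsPolarForm k q Q) :
    MvPolynomial.eval x q = splineSum a χ sel P k Q x := by
  have h := hP.sum_polarAt_spline hsel (hgen.respectsRelations hχy sel) hχ
    (by simp only [hχy]; exact hP.sum_closedInd (by omega) hy hgen) (by omega) hx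
    ⟨hQ.symm, hQ.affine⟩
  rw [splineSum, Finset.sum_congr rfl fun T hT => by
    rw [volume_tile (hP.basis T (Finset.mem_filter.1 hT).1).1], h, hQ.diag]
  have h1 : (k.factorial : ℝ) ≠ 0 := by exact_mod_cast k.factorial_ne_zero
  have h2 : ((k + d).factorial : ℝ) ≠ 0 := by exact_mod_cast (k + d).factorial_ne_zero
  field_simp

theorem chk_subset_hull_univ {a : Fin n → Fin d → ℝ} {k : ℕ} (hk : k ≤ n) :
    chk a k ⊆ hull a Finset.univ := by
  intro x hx
  obtain ⟨J, -, hJ⟩ := Finset.exists_subset_card_eq (s := (Finset.univ : Finset (Fin n))) (n := k)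
    (by simpa using hk)
  exact hull_mono (Finset.subset_univ _) (mem_hull_compl_of_mem_chk hx hJ)

end ZonotopalSpline

end

theorem theorem3 {d n : ℕ} (a : Fin n → Fin d → ℝ)
    (ha : affineSpan ℝ (Set.range a) = ⊤)
    (P : Finset (Finset (Fin n) × Finset (Fin n)))
    (hP : ZonotopalSpline.IsFineZonotopalTiling a P)
    (k : ℕ) (hk : k + d + 1 ≤ n)
    (sel : Finset (Fin n) → Finset (Fin n)) (hsel : ZonotopalSpline.IsSelection a sel)
    (q : MvPolynomial (Fin d) ℝ) (hq : q.totalDegree ≤ k) :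
    (∃ Q : (Fin k → Fin d → ℝ) → ℝ, ZonotopalSpline.IsPolarForm k q Q) ∧
    ∀ Q : (Fin k → Fin d → ℝ) → ℝ, ZonotopalSpline.IsPolarForm k q Q →
      (∀ x ∈ ZonotopalSpline.chk a k,
        (∀ S : Finset (Fin n), S.card = d → x ∉ ZonotopalSpline.hull a S) →
        MvPolynomial.eval x q =
          ZonotopalSpline.splineSum a (ZonotopalSpline.closedInd a) sel P k Q x) ∧
      (∀ p ∈ convexHull ℝ (Set.range a),
        (∀ S : Finset (Fin n), S.card = d → p ∉ affineSpan ℝ (a '' (S : Set (Fin n)))) →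
        ∀ x ∈ ZonotopalSpline.chk a k,
          MvPolynomial.eval x q =
            ZonotopalSpline.splineSum a (ZonotopalSpline.halfOpenInd a p) sel P k Q x) := by
  open ZonotopalSpline in
  refine ⟨exists_isPolarForm q hq, fun Q hQ => ⟨fun x hx hgen => ?_, fun p hpA hp x hx => ?_⟩⟩
  -- Here x is generic itself and serves as y.
  · refine hP.eval_eq_splineSum hsel (fun B _ h => ?_) (chk_subset_hull_univ (by omega) hx) hgen
      (fun B => rfl) hk hx hQ
    by_contra hxB
    exact h (Set.indicator_of_notMem hxB _)
  · obtain ⟨y, hy, hygen, hχ⟩ := exists_generic_model (chk_subset_hull_univ (by omega) hx)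
      (by simpa [hull] using hpA) hp
    exact hP.eval_eq_splineSum hsel (fun B _ h => mem_hull_of_halfOpenInd_ne_zero h) hy hygen hχ
      hk hx hQ
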